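/- Let $V$ be a complex Hilbert space with inner product $\langle\cdot|\cdot\rangle$ (antilinear in the first variable), let $SV=\bigoplus_d S^dV$ be its symmetric algebra with the inner product for which the summands are mutually perpendicular and $\langle x_1\cdots x_d|y_1\cdots y_d\rangle=\sum_\pi\prod_k\langle x_k|y_{\pi(k)}\rangle$, and let $SV'$ be the space of all antilinear functionals $SV\to\mathbb C$, a commutative algebra under $[\Phi\Psi](\theta)=[\Phi\otimes\Psi](\Delta\theta)$, where $\Delta:SV\to SV\otimes SV$ is the algebra homomorphism with $\Delta v=v\otimes1+1\otimes v$ for $v\in V$. For $\Phi\in SV'$, $d\in\mathbb N$ and a finite-dimensional subspace $M\subset V$ let $\Phi_M^d\in S^dM$ be the element with $\Phi=\langle\cdot|\Phi_M^d\rangle$ on $S^dM$, and put $\|\Phi\|=\sup_M\bigl(\sum_d\|\Phi_M^d\|^2\bigr)^{1/2}\in[0,\infty]$. Symmetric Fock space is $S[V]=\{\Phi\in SV':\|\Phi\|<\infty\}$, with the inner product $\langle\Phi|\Psi\rangle=\frac14\sum_{p=0}^3 i^{-p}\|\Phi+i^p\Psi\|^2$. A bounded antilinear map $Z:V\to V$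 is symmetric if $\langle y|Zx\rangle=\langle x|Zy\rangle$ for all $x,y\in V$; its Gaussian is $e^Z=\sum_{n\ge0}\zeta^n/n!\in SV'$ (a weakly convergent series), where $\zeta\in SV'$ is the functional that vanishes on $S^dV$ for $d\neq2$ and satisfies $\zeta(xy)=\langle y|Zx\rangle$ for $x,y\in V$. **Theorem.** Let $X,Y:V\to V$ be symmetric antilinear Hilbert–Schmidt maps with operator norms $\|X\|<1$ and $\|Y\|<1$. Then $e^X$ and $e^Y$ lie in $S[V]$, the complex-linear operator $YX$ is of trace class, and \[\langle e^X|e^Y\rangle=\bigl(\mathrm{Det}^{1/2}(I-YX)\bigr)^{-1}.\] Here $\mathrm{Det}(I+A)$, for $A$ of trace class, is the Fredholm determinant, the limit of $\det\bigl((I+P_MA)|_M\bigr)$ over the finite-dimensional subspaces $M\subset V$ directed by inclusion, with $P_M$ the orthogonal projection on $M$; and $\mathrm{Det}^{1/2}(I-YX)$ is the value at $t=1$ of the continuous function $s:[0,1]\to\mathbb C$ with $s(0)=1$ and $s(t)^2=\mathrm{Det}(I-tYX)$; the value $s(1)$ exists, is nonzero and is uniquely determined by these conditions. -/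

import Mathlib

open scoped TensorProduct ComplexConjugate ENNReal

noncomputable section

namespace BosonicFock

variable {V : Type*} [NormedAddCommGroup V] [InnerProductSpace ℂ V]

/-- The symmetric algebra `SV` of the complex vector space underlying `V`. -/
abbrev Sym (V : Type*) [NormedAddCommGroup V] [InnerProductSpace ℂ V] : Type _ :=
  SymmetricAlgebra ℂ V

/-- The canonical inclusion of `V` in its symmetric algebra `SV`. -/
abbrev inc : V →ₗ[ℂ] Sym V := SymmetricAlgebra.ι ℂ V

/-- The full antidual `SV'`: all antilinear functionals on `SV`. -/
abbrev Antidual (V : Type*) [NormedAddCommGroup V] [InnerProductSpace ℂ V] : Type _ :=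
  Sym V →ₗ⋆[ℂ] ℂ

/-! ### The commutative algebra `SV'` -/

/-- The antilinear functional `Φ ⊗ Ψ` on `SV ⊗ SV`. -/
def tensor (Φ Ψ : Antidual V) : (Sym V ⊗[ℂ] Sym V) →ₗ⋆[ℂ] ℂ :=
  TensorProduct.lift
    (LinearMap.mk₂'ₛₗ (starRingEnd ℂ) (starRingEnd ℂ) (fun a b => Φ a * Ψ b)
      (by intros; simp [add_mul]) (by intros; simp [mul_assoc])
      (by intros; simp [mul_add]) (by intros; simp [mul_left_comm]))

@[simp] theorem tensor_tmul (Φ Ψ : Antidual V) (a b : Sym V) :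
    tensor Φ Ψ (a ⊗ₜ[ℂ] b) = Φ a * Ψ b := rfl

/-- The product of `SV'`: `[ΦΨ](θ) = [Φ ⊗ Ψ](Δθ)`, where the coproduct `Δ` is the algebra
homomorphism `SV → SV ⊗ SV` with `Δ v = v ⊗ 1 + 1 ⊗ v` for `v` in `V`. -/
def mul (Φ Ψ : Antidual V) : Antidual V :=
  (tensor Φ Ψ).comp (Coalgebra.comul (R := ℂ) (A := Sym V))

/-- The unit of `SV'`: the (conjugated) augmentation of `SV`. -/
def one : Antidual V where
  toFun θ := conj (Coalgebra.counit (R := ℂ) θ)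
  map_add' := by intros; simp
  map_smul' := by intros; simp

/-- Conjugation, as a bijection of `SV'` onto the convolution algebra dual to `SV`. -/
def toConvDual (Φ : Antidual V) : WithConv (Sym V →ₗ[ℂ] ℂ) :=
  WithConv.toConv
    { toFun := fun θ => conj (Φ θ)
      map_add' := by intros; simp
      map_smul' := by intros; simp }

theorem toConvDual_apply (Φ : Antidual V) (θ : Sym V) : toConvDual Φ θ = conj (Φ θ) := rfl

theorem toConvDual_injective : Function.Injective (toConvDual (V := V)) := by
  intro Φ Ψ h
  ext θ
  have := congrArg (fun f : WithConv (Sym V →ₗ[ℂ] ℂ) => f θ) h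
  exact (starRingEnd ℂ).injective this

theorem toConvDual_add (Φ Ψ : Antidual V) :
    toConvDual (Φ + Ψ) = toConvDual Φ + toConvDual Ψ := by
  ext θ
  change conj ((Φ + Ψ) θ) = conj (Φ θ) + conj (Ψ θ)
  simp

theorem toConvDual_one : toConvDual (one : Antidual V) = 1 := by
  ext θ
  change conj (conj (Coalgebra.counit (R := ℂ) θ)) = _
  simp

theorem toConvDual_mul (Φ Ψ : Antidual V) :
    toConvDual (mul Φ Ψ) = toConvDual Φ * toConvDual Ψ := by
  ext θ
  rw [LinearMap.convMul_apply]
  change conj (tensor Φ Ψ (Coalgebra.comul (R := ℂ) θ)) = _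
  induction Coalgebra.comul (R := ℂ) θ using TensorProduct.induction_on with
  | zero => simp
  | tmul a b => simp; rfl
  | add x y hx hy => simp only [map_add, hx, hy]

instance : CommRing (Antidual V) where
  __ := (inferInstance : AddCommGroup (Sym V →ₗ⋆[ℂ] ℂ))
  mul := mul
  one := one
  mul_assoc a b c := toConvDual_injective (by
    change toConvDual (mul (mul a b) c) = toConvDual (mul a (mul b c))
    simp only [toConvDual_mul, mul_assoc])
  mul_comm a b := toConvDual_injective (by
    change toConvDual (mul a b) = toConvDual (mul b a)
    simp only [toConvDual_mul, mul_comm])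
  one_mul a := toConvDual_injective (by
    change toConvDual (mul one a) = _
    simp only [toConvDual_mul, toConvDual_one, one_mul])
  mul_one a := toConvDual_injective (by
    change toConvDual (mul a one) = _
    simp only [toConvDual_mul, toConvDual_one, mul_one])
  left_distrib a b c := toConvDual_injective (by
    change toConvDual (mul a (b + c)) = toConvDual (mul a b + mul a c)
    simp only [toConvDual_mul, toConvDual_add, mul_add])
  right_distrib a b c := toConvDual_injective (by
    change toConvDual (mul (a + b) c) = toConvDual (mul a c + mul b c)
    simp only [toConvDual_mul, toConvDual_add, add_mul])
  zero_mul a := toConvDual_injective (by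
    change toConvDual (mul 0 a) = _
    have h0 : toConvDual (0 : Antidual V) = 0 := by
      have := toConvDual_add (0 : Antidual V) 0
      simpa using this
    simp only [toConvDual_mul, h0, zero_mul])
  mul_zero a := toConvDual_injective (by
    change toConvDual (mul a 0) = _
    have h0 : toConvDual (0 : Antidual V) = 0 := by
      have := toConvDual_add (0 : Antidual V) 0
      simpa using this
    simp only [toConvDual_mul, h0, mul_zero])

theorem mul_apply (Φ Ψ : Antidual V) (θ : Sym V) :
    (Φ * Ψ) θ = tensor Φ Ψ (Coalgebra.comul (R := ℂ) θ) := rfl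

theorem one_apply (θ : Sym V) : (1 : Antidual V) θ = conj (Coalgebra.counit (R := ℂ) θ) := rfl

theorem smul_mul (c : ℂ) (Φ Ψ : Antidual V) : c • Φ * Ψ = c • (Φ * Ψ) := by
  ext θ
  simp only [mul_apply, LinearMap.smul_apply]
  induction Coalgebra.comul (R := ℂ) θ using TensorProduct.induction_on with
  | zero => simp
  | tmul a b => simp [mul_assoc]
  | add x y hx hy => simp only [map_add, hx, hy, smul_add]

instance : Algebra ℂ (Antidual V) :=
  Algebra.ofModule smul_mul (fun c Φ Ψ => by rw [mul_comm, smul_mul, mul_comm])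

/-! ### The standard inner product of `SV` -/

/-- The projection of `SV` on its summand `S¹V = V` of degree one. -/
def linPart : Sym V →ₗ[ℂ] V :=
  letI : Module ℂᵐᵒᵖ V := Module.compHom _ ((RingHom.id ℂ).fromOpposite mul_comm)
  haveI : IsCentralScalar ℂ V := ⟨fun _ _ => rfl⟩
  (TrivSqZeroExt.sndHom ℂ V).comp
    (SymmetricAlgebra.lift (TrivSqZeroExt.inrHom ℂ V)).toLinearMap

@[simp] theorem linPart_inc (v : V) : linPart (inc v) = v := by
  simp [linPart]

@[simp] theorem linPart_one : linPart (1 : Sym V) = 0 := by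
  let _ : Module ℂᵐᵒᵖ V := Module.compHom _ ((RingHom.id ℂ).fromOpposite mul_comm)
  have _ : IsCentralScalar ℂ V := ⟨fun _ _ => rfl⟩
  simp [linPart, map_one]

theorem linPart_mul (a b : Sym V) :
    linPart (a * b) = Coalgebra.counit (R := ℂ) a • linPart b +
      Coalgebra.counit (R := ℂ) b • linPart a := by
  let _ : Module ℂᵐᵒᵖ V := Module.compHom _ ((RingHom.id ℂ).fromOpposite mul_comm)
  have _ : IsCentralScalar ℂ V := ⟨fun _ _ => rfl⟩
  have h : (TrivSqZeroExt.fstHom ℂ ℂ V).comp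
      (SymmetricAlgebra.lift (TrivSqZeroExt.inrHom ℂ V)) = SymmetricAlgebra.algebraMapInv := by
    apply SymmetricAlgebra.algHom_ext
    ext v
    simp [SymmetricAlgebra.algebraMapInv_ι]
  have h' : ∀ c : Sym V, (SymmetricAlgebra.lift (TrivSqZeroExt.inrHom ℂ V) c).fst =
      Coalgebra.counit (R := ℂ) c := fun c => congrArg (fun f => f c) h
  simp [linPart, h']

/-- The element `⟨· | v⟩` of `SV'`; it vanishes on the summands of degree other than one. -/
def vec : V →ₗ[ℂ] Antidual V where
  toFun v :=
    { toFun := fun θ => inner ℂ (linPart θ) v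
      map_add' := by intros; simp
      map_smul' := by intros; simp [mul_comm] }
  map_add' := by intros; ext; simp
  map_smul' := by intros; ext; simp

/-- The canonical inclusion `SV → SV' : φ ↦ ⟨· | φ⟩`, which is the homomorphism of algebras that
extends `v ↦ ⟨· | v⟩`. -/
def toAntidual : Sym V →ₐ[ℂ] Antidual V := SymmetricAlgebra.lift vec

/-- The standard inner product `⟨φ | ψ⟩` of `SV`, antilinear in `φ`; see `symInner_prod`. -/
def symInner (φ ψ : Sym V) : ℂ := toAntidual ψ φ

/-- The extended annihilator `a(v)` on `SV'`: `[a(v)Φ](ψ) = Φ(vψ)`. -/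
def annih (v : V) : Antidual V →ₗ[ℂ] Antidual V where
  toFun Φ :=
    { toFun := fun θ => Φ (inc v * θ)
      map_add' := by intros; simp [mul_add]
      map_smul' := by intros; simp }
  map_add' := by intros; rfl
  map_smul' := by intros; rfl

theorem annih_apply (v : V) (Φ : Antidual V) (θ : Sym V) : annih v Φ θ = Φ (inc v * θ) := rfl

theorem annih_mul (v : V) (Φ Ψ : Antidual V) :
    annih v (Φ * Ψ) = annih v Φ * Ψ + Φ * annih v Ψ := by
  ext θ
  rw [annih_apply, mul_apply, LinearMap.add_apply, mul_apply, mul_apply, Bialgebra.comul_mul,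
    SymmetricAlgebra.comul_ι]
  induction Coalgebra.comul (R := ℂ) θ using TensorProduct.induction_on with
  | zero => simp
  | tmul a b => simp [add_mul, annih_apply]
  | add x y hx hy =>
    rw [mul_add, map_add, hx, hy]
    simp only [map_add]
    ring

theorem annih_vec (v w : V) : annih v (vec w) = (inner ℂ v w : ℂ) • (1 : Antidual V) := by
  ext θ
  change inner ℂ (linPart (inc v * θ)) w = inner ℂ v w * conj (Coalgebra.counit (R := ℂ) θ)
  rw [linPart_mul]
  simp

theorem annih_one (v : V) : annih v (1 : Antidual V) = 0 := by
  ext θ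
  simp [annih_apply, one_apply]

theorem apply_one_mul (Φ Ψ : Antidual V) : (Φ * Ψ) 1 = Φ 1 * Ψ 1 := by
  rw [mul_apply, Bialgebra.comul_one, Algebra.TensorProduct.one_def, tensor_tmul]

theorem annih_prod (v : V) : ∀ (n : ℕ) (f : Fin n → Antidual V),
    annih v (∏ k, f k) = ∑ j, annih v (f j) * ∏ k ∈ Finset.univ.erase j, f k := by
  intro n f
  have : ∀ s : Finset (Fin n),
      annih v (∏ k ∈ s, f k) = ∑ j ∈ s, annih v (f j) * ∏ k ∈ s.erase j, f k := by
    intro s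
    induction s using Finset.induction_on with
    | empty => simp [annih_one]
    | insert a s ha ih =>
      rw [Finset.prod_insert ha, annih_mul, ih, Finset.sum_insert ha, Finset.erase_insert ha,
        Finset.mul_sum]
      congr 1
      refine Finset.sum_congr rfl fun j hj => ?_
      have hne : a ≠ j := fun h => ha (h ▸ hj)
      rw [Finset.erase_insert_of_ne hne, Finset.prod_insert (by simp [ha])]
      ring
  exact this Finset.univ

theorem toAntidual_prod {n : ℕ} (y : Fin n → V) :
    toAntidual (∏ k, inc (y k)) = ∏ k, vec (y k) := by
  simp [toAntidual, map_prod]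

theorem annih_prod_vec {n : ℕ} (v : V) (y : Fin (n + 1) → V) :
    annih v (∏ k, vec (y k)) =
      ∑ j, (inner ℂ v (y j) : ℂ) • ∏ k : Fin n, vec (y (Equiv.swap 0 j k.succ)) := by
  rw [annih_prod]
  refine Finset.sum_congr rfl fun j _ => ?_
  rw [annih_vec, smul_mul_assoc, one_mul]
  congr 1
  have h : Finset.univ.erase j = Finset.univ.image fun k : Fin n => Equiv.swap 0 j k.succ := by
    ext i
    simp only [Finset.mem_erase, Finset.mem_univ, and_true, Finset.mem_image, true_and]
    constructor
    · intro hi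
      have h0 : Equiv.swap 0 j i ≠ 0 := by
        rw [Ne, Equiv.swap_apply_eq_iff, Equiv.swap_apply_left]
        exact hi
      obtain ⟨k, hk⟩ := Fin.exists_succ_eq.2 h0
      exact ⟨k, by rw [hk, Equiv.swap_apply_self]⟩
    · rintro ⟨k, rfl⟩ hk
      rw [Equiv.swap_apply_eq_iff, Equiv.swap_apply_right] at hk
      exact Fin.succ_ne_zero k hk
  rw [h, Finset.prod_image]
  intro a _ b _ hab
  exact Fin.succ_injective _ ((Equiv.swap 0 j).injective hab)

/-- The inner product of two products of the same number of vectors is a permanent. -/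
theorem symInner_prod : ∀ {d : ℕ} (x y : Fin d → V),
    symInner (∏ k, inc (x k)) (∏ k, inc (y k)) =
      ∑ π : Equiv.Perm (Fin d), ∏ k, inner ℂ (x k) (y (π k)) := by
  intro d
  induction d with
  | zero => intro x y; simp [symInner, one_apply]
  | succ d ih =>
    intro x y
    have ih' : ∀ x y : Fin d → V, (∏ k, vec (y k)) (∏ k, inc (x k)) =
        ∑ π : Equiv.Perm (Fin d), ∏ k, inner ℂ (x k) (y (π k)) := fun x y => by
      rw [← ih x y, symInner, toAntidual_prod]
    rw [symInner, toAntidual_prod, Fin.prod_univ_succ (fun k => inc (x k)), ← annih_apply,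
      annih_prod_vec, ← Equiv.Perm.decomposeFin.symm.sum_comp, Fintype.sum_prod_type, LinearMap.sum_apply]
    refine Finset.sum_congr rfl fun j _ => ?_
    rw [LinearMap.smul_apply, ih' _ (fun k => y (Equiv.swap 0 j k.succ)), smul_eq_mul,
      Finset.mul_sum]
    refine Finset.sum_congr rfl fun σ _ => ?_
    rw [Fin.prod_univ_succ]
    simp

/-- The homogeneous summands of `SV` are mutually perpendicular. -/
theorem symInner_prod_of_ne : ∀ {m n : ℕ} (_ : m ≠ n) (x : Fin m → V) (y : Fin n → V),
    symInner (∏ k, inc (x k)) (∏ k, inc (y k)) = 0 := by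
  intro m
  induction m with
  | zero =>
    intro n hn x y
    obtain ⟨n, rfl⟩ := Nat.exists_eq_succ_of_ne_zero hn.symm
    rw [symInner, toAntidual_prod, Fin.prod_univ_succ, Fin.prod_univ_zero, apply_one_mul]
    have : vec (y 0) (1 : Sym V) = 0 := by
      change inner ℂ (linPart 1) (y 0) = 0
      simp
    rw [this, zero_mul]
  | succ m ih =>
    intro n hn x y
    rw [symInner, toAntidual_prod, Fin.prod_univ_succ, ← annih_apply]
    cases n with
    | zero => simp [annih_one]
    | succ n =>
      rw [annih_prod_vec, LinearMap.sum_apply]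
      refine Finset.sum_eq_zero fun j _ => ?_
      rw [LinearMap.smul_apply, ← toAntidual_prod fun k => y (Equiv.swap 0 j k.succ)]
      change _ • symInner _ _ = 0
      rw [ih (by omega), smul_zero]

/-! ### The components `Φ_M^d` -/

/-- For a subspace `M` of `V`, the homogeneous summand `S^d M` of degree `d` of `SM`, as a subspace
of `SV`: the span of all products of `d` vectors from `M`. -/
def symPow (M : Submodule ℂ V) (d : ℕ) : Submodule ℂ (Sym V) := (M.map inc) ^ d

/-- The product of `d` members of a family of vectors. -/
def monom {m d : ℕ} (e : Fin m → V) (f : Fin d → Fin m) : Sym V := ∏ k, inc (e (f k))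

theorem monom_comp_perm {m d : ℕ} (e : Fin m → V) (f : Fin d → Fin m)
    (π : Equiv.Perm (Fin d)) : monom e (f ∘ π) = monom e f :=
  Equiv.prod_comp π fun k => inc (e (f k))

theorem symPow_eq_span {m d : ℕ} (M : Submodule ℂ V) (e : Fin m → V)
    (he : Submodule.span ℂ (Set.range e) = M) :
    symPow M d = Submodule.span ℂ (Set.range fun f : Fin d → Fin m => monom e f) := by
  rw [symPow, ← he, Submodule.map_span, Submodule.span_pow]
  congr 1
  ext a
  rw [Set.mem_pow]
  constructor
  · rintro ⟨f, rfl⟩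
    have h : ∀ k, ∃ i, inc (e i) = (f k : Sym V) := fun k => by
      obtain ⟨_, ⟨i, rfl⟩, hi⟩ := (f k).2
      exact ⟨i, hi⟩
    choose g hg using h
    refine ⟨g, ?_⟩
    simp only [monom, List.prod_ofFn, hg]
  · rintro ⟨f, rfl⟩
    refine ⟨fun k => ⟨inc (e (f k)), ⟨e (f k), ⟨f k, rfl⟩, rfl⟩⟩, ?_⟩
    simp only [monom, List.prod_ofFn]

theorem prod_inner_eq {m d : ℕ} {e : Fin m → V} (he : Orthonormal ℂ e) (f g : Fin d → Fin m) :
    ∏ k, inner ℂ (e (f k)) (e (g k)) = if f = g then (1 : ℂ) else 0 := by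
  simp only [orthonormal_iff_ite.1 he]
  split_ifs with h
  · simp [h]
  · obtain ⟨k, hk⟩ := Function.ne_iff.1 h
    exact Finset.prod_eq_zero (Finset.mem_univ k) (if_neg hk)

theorem sum_symInner_smul {E : Type*} [AddCommGroup E] [Module ℂ E] {m d : ℕ} {e : Fin m → V}
    (he : Orthonormal ℂ e) (F : (Fin d → Fin m) → E)
    (hF : ∀ f (π : Equiv.Perm (Fin d)), F (f ∘ π) = F f) (g : Fin d → Fin m) :
    ∑ f, symInner (monom e f) (monom e g) • F f = (d.factorial : ℂ) • F g := by
  simp only [monom, symInner_prod, Finset.sum_smul]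
  rw [Finset.sum_comm]
  have h : ∀ π : Equiv.Perm (Fin d),
      ∑ f : Fin d → Fin m, (∏ k, inner ℂ (e (f k)) (e (g (π k)))) • F f = F g := fun π => by
    have h1 : ∀ f : Fin d → Fin m, (∏ k, inner ℂ (e (f k)) (e (g (π k)))) =
        if f = g ∘ π then (1 : ℂ) else 0 := fun f => prod_inner_eq he f (g ∘ π)
    simp [h1, hF]
  simp [h, Fintype.card_perm, Nat.cast_smul_eq_nsmul]

theorem sum_symInner_smul' {E : Type*} [AddCommGroup E] [Module ℂ E] {m d : ℕ} {e : Fin m → V}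
    (he : Orthonormal ℂ e) (F : (Fin d → Fin m) → E)
    (hF : ∀ f (π : Equiv.Perm (Fin d)), F (f ∘ π) = F f) (g : Fin d → Fin m) :
    ∑ f, symInner (monom e g) (monom e f) • F f = (d.factorial : ℂ) • F g := by
  rw [← sum_symInner_smul he F hF g]
  refine Finset.sum_congr rfl fun f _ => ?_
  congr 1
  simp only [monom, symInner_prod]
  rw [← Equiv.sum_comp (Equiv.inv (Equiv.Perm (Fin d)))]
  refine Finset.sum_congr rfl fun π _ => ?_
  rw [← Equiv.prod_comp π]
  refine Finset.prod_congr rfl fun k _ => ?_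
  have hk : (Equiv.inv (Equiv.Perm (Fin d)) π) (π k) = k := π.symm_apply_apply k
  rw [hk, orthonormal_iff_ite.1 he, orthonormal_iff_ite.1 he]
  simp only [eq_comm]

/-- The restriction of `Φ` to `S^d M` is represented by a unique element `Φ_M^d` of `S^d M`. -/
theorem existsUnique_component (M : Submodule ℂ V) [FiniteDimensional ℂ M] (d : ℕ)
    (Φ : Antidual V) :
    ∃! φ : Sym V, φ ∈ symPow M d ∧ ∀ ψ ∈ symPow M d, Φ ψ = symInner ψ φ := by
  let b := stdOrthonormalBasis ℂ M
  let e : Fin (Module.finrank ℂ M) → V := fun i => b i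
  have he : Orthonormal ℂ e := b.orthonormal.comp_linearIsometry M.subtypeₗᵢ
  have hspan : Submodule.span ℂ (Set.range e) = M := by
    have h := congrArg (Submodule.map M.subtype) b.toBasis.span_eq
    rw [Submodule.map_span, Submodule.map_top, Submodule.range_subtype, ← Set.range_comp] at h
    simpa [Function.comp_def, e] using h
  have hd : (d.factorial : ℂ) ≠ 0 := Nat.cast_ne_zero.2 d.factorial_ne_zero
  have hS := symPow_eq_span (d := d) M e hspan
  have hmem : ∀ f : Fin d → Fin (Module.finrank ℂ M), monom e f ∈ symPow M d := fun f => by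
    rw [hS]
    exact Submodule.subset_span ⟨f, rfl⟩
  refine ⟨∑ f : Fin d → Fin (Module.finrank ℂ M), ((d.factorial : ℂ)⁻¹ * Φ (monom e f)) •
    monom e f, ⟨?_, ?_⟩, ?_⟩
  · exact Submodule.sum_mem _ fun f _ => Submodule.smul_mem _ _ (hmem f)
  · intro ψ hψ
    rw [hS] at hψ
    induction hψ using Submodule.span_induction with
    | mem x hx =>
      obtain ⟨g, rfl⟩ := hx
      have h := sum_symInner_smul' he (fun f => Φ (monom e f))
        (fun f π => by rw [monom_comp_perm]) g
      simp only [smul_eq_mul] at h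
      simp only [symInner, map_sum, map_smul, LinearMap.sum_apply, LinearMap.smul_apply,
        smul_eq_mul]
      have h2 : ∀ f : Fin d → Fin (Module.finrank ℂ M),
          (d.factorial : ℂ)⁻¹ * Φ (monom e f) * toAntidual (monom e f) (monom e g) =
          (d.factorial : ℂ)⁻¹ * (symInner (monom e g) (monom e f) * Φ (monom e f)) := fun f => by
        rw [symInner]
        ring
      rw [Finset.sum_congr rfl fun f _ => h2 f, ← Finset.mul_sum, h, inv_mul_cancel_left₀ hd]
    | zero => simp [symInner]
    | add x y _ _ hx hy =>
      rw [map_add, hx, hy, symInner, symInner, symInner, map_add]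
    | smul c x _ hx =>
      rw [map_smulₛₗ, hx, symInner, symInner, map_smulₛₗ]
  · have key : ∀ φ ∈ symPow M d, (d.factorial : ℂ) • φ =
        ∑ f : Fin d → Fin (Module.finrank ℂ M), symInner (monom e f) φ • monom e f := by
      intro φ hφ
      rw [hS] at hφ
      induction hφ using Submodule.span_induction with
      | mem x hx =>
        obtain ⟨g, rfl⟩ := hx
        exact (sum_symInner_smul he (fun f => monom e f) (fun f π => monom_comp_perm e f π) g).symm
      | zero => simp [symInner]
      | add x y _ _ hx hy =>
        rw [smul_add, hx, hy, ← Finset.sum_add_distrib]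
        simp [symInner, add_smul]
      | smul c x _ hx =>
        rw [smul_comm, hx, Finset.smul_sum]
        simp [symInner, mul_smul]
    rintro φ ⟨hφ, hrep⟩
    have h1 := key φ hφ
    simp only [← hrep _ (hmem _)] at h1
    have h2 := congrArg ((d.factorial : ℂ)⁻¹ • ·) h1
    simp only [inv_smul_smul₀ hd] at h2
    rw [h2, Finset.smul_sum]
    simp only [mul_smul]

/-- The component `Φ_M^d`: the element of `S^d M` such that `Φ = ⟨· | Φ_M^d⟩` on `S^d M`. -/
def component (M : Submodule ℂ V) [FiniteDimensional ℂ M] (d : ℕ) (Φ : Antidual V) : Sym V :=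
  (existsUnique_component M d Φ).choose

/-! ### Symmetric Fock space -/

/-- The set `𝓕(V)` of all finite-dimensional subspaces of `V`, ordered by inclusion. -/
abbrev FinSub (V : Type*) [NormedAddCommGroup V] [InnerProductSpace ℂ V] : Type _ :=
  {M : Submodule ℂ V // FiniteDimensional ℂ M}

instance (M : FinSub V) : FiniteDimensional ℂ M.1 := M.2

/-- `‖Φ_M‖ = (∑ d, ‖Φ_M^d‖²)^(1/2)`, a number in `[0, ∞]`. -/
def normOn (M : FinSub V) (Φ : Antidual V) : ℝ≥0∞ :=
  (∑' d : ℕ, ENNReal.ofReal (symInner (component M.1 d Φ) (component M.1 d Φ)).re) ^ (1 / 2 : ℝ)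

/-- `‖Φ‖ = sup_M ‖Φ_M‖`, a number in `[0, ∞]`. -/
def fockNorm (Φ : Antidual V) : ℝ≥0∞ := ⨆ M : FinSub V, normOn M Φ

/-- Symmetric Fock space `S[V] = {Φ ∈ SV' : ‖Φ‖ < ∞}`. -/
def fockSpace (V : Type*) [NormedAddCommGroup V] [InnerProductSpace ℂ V] : Set (Antidual V) :=
  {Φ | fockNorm Φ < ∞}

/-- The inner product `⟨Φ | Ψ⟩ = (1/4) ∑_{p=0}^{3} i^{-p} ‖Φ + i^p Ψ‖²` of `Φ, Ψ ∈ S[V]`. -/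
def fockInner (Φ Ψ : Antidual V) : ℂ :=
  (1 / 4) * ∑ p ∈ Finset.range 4,
    (Complex.I ^ p)⁻¹ * (((fockNorm (Φ + Complex.I ^ p • Ψ)).toReal ^ 2 : ℝ) : ℂ)

/-! ### Gaussians -/

/-- `Z` is symmetric: `⟨y | Zx⟩ = ⟨x | Zy⟩`. -/
def IsSymm (Z : V →L⋆[ℂ] V) : Prop := ∀ x y : V, (inner ℂ y (Z x) : ℂ) = inner ℂ x (Z y)

/-- `Z` is of Hilbert–Schmidt class: `∑ ‖Z bᵢ‖² < ∞` for a Hilbert (unitary) basis `b`; by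
Parseval's identity the choice of `b` is immaterial. -/
def IsHilbertSchmidt (Z : V →L⋆[ℂ] V) : Prop :=
  ∃ (s : Set V) (b : HilbertBasis s ℂ V), Summable fun i => ‖Z (b i)‖ ^ 2

/-- The antilinear functional `x ⊗ y ↦ ⟨y | Zx⟩` on `V ⊗ V`. -/
def pairing (Z : V →L⋆[ℂ] V) : V ⊗[ℂ] V →ₗ⋆[ℂ] ℂ :=
  TensorProduct.lift
    (LinearMap.mk₂'ₛₗ (starRingEnd ℂ) (starRingEnd ℂ) (fun x y => inner ℂ y (Z x))
      (by intros; simp) (by intros; simp) (by intros; simp) (by intros; simp [mul_comm]))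

/-- The quadratic `ζ` in `S²V'` that corresponds to `Z`: the element of `SV'` with
`ζ(xy) = ⟨y | Zx⟩` which vanishes on the summands of degree other than two;
see `quadratic_two` and `quadratic_prod_of_ne`. -/
def quadratic (Z : V →L⋆[ℂ] V) : Antidual V :=
  (1 / 2 : ℂ) • (pairing Z).comp
    ((TensorProduct.map linPart linPart).comp (Coalgebra.comul (R := ℂ) (A := Sym V)))

theorem quadratic_one (Z : V →L⋆[ℂ] V) : quadratic Z 1 = 0 := by
  simp [quadratic, Bialgebra.comul_one, Algebra.TensorProduct.one_def]

theorem annih_quadratic {Z : V →L⋆[ℂ] V} (hZ : IsSymm Z) (v : V) :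
    annih v (quadratic Z) = vec (Z v) := by
  have key : ∀ t : Sym V ⊗[ℂ] Sym V,
      pairing Z (TensorProduct.map linPart linPart ((inc v ⊗ₜ[ℂ] 1 + 1 ⊗ₜ[ℂ] inc v) * t)) =
        tensor 1 (vec (Z v)) t + tensor (vec (Z v)) 1 t := by
    intro t
    induction t using TensorProduct.induction_on with
    | zero => simp
    | tmul a b =>
      have h : (inner ℂ v (Z (linPart a)) : ℂ) = inner ℂ (linPart a) (Z v) := hZ _ _
      rw [add_mul]
      simp [linPart_mul, pairing, one_apply, vec, h]
      ring
    | add x y hx hy =>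
      rw [mul_add, map_add, map_add, hx, hy, map_add, map_add]
      ring
  ext θ
  have h : annih v (quadratic Z) θ = (1 / 2 : ℂ) * (tensor 1 (vec (Z v))
      (Coalgebra.comul (R := ℂ) θ) + tensor (vec (Z v)) 1 (Coalgebra.comul (R := ℂ) θ)) := by
    rw [← key, ← SymmetricAlgebra.comul_ι, ← Bialgebra.comul_mul]
    rfl
  rw [h, ← mul_apply, ← mul_apply, one_mul, mul_one]
  ring

theorem quadratic_two {Z : V →L⋆[ℂ] V} (hZ : IsSymm Z) (x y : V) :
    quadratic Z (inc x * inc y) = inner ℂ y (Z x) := by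
  rw [← annih_apply, annih_quadratic hZ]
  simp [vec]

theorem quadratic_prod_of_ne {Z : V →L⋆[ℂ] V} (hZ : IsSymm Z) {d : ℕ} (hd : d ≠ 2)
    (x : Fin d → V) : quadratic Z (∏ k, inc (x k)) = 0 := by
  match d with
  | 0 => simp [quadratic_one]
  | 1 => rw [Fin.prod_univ_succ, ← annih_apply, annih_quadratic hZ]; simp [vec]
  | 2 => exact absurd rfl hd
  | d + 3 =>
    rw [Fin.prod_univ_succ, ← annih_apply, annih_quadratic hZ]
    simp [vec, Fin.prod_univ_succ, linPart_mul, Bialgebra.counit_mul]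

theorem annih_pow_mul (v : V) (Φ Ψ : Antidual V) (n : ℕ) :
    annih v (Φ ^ (n + 1) * Ψ) =
      ((n + 1 : ℕ) : ℂ) • (Φ ^ n * (annih v Φ * Ψ)) + Φ ^ n * (Φ * annih v Ψ) := by
  induction n generalizing Ψ with
  | zero => simp [annih_mul]
  | succ n ih =>
    rw [pow_succ, mul_assoc, ih, annih_mul, mul_add, mul_add, pow_succ, Nat.cast_succ (n + 1),
      add_smul, one_smul, mul_left_comm (annih v Φ) Φ Ψ]
    simp only [mul_assoc]
    abel

/-- Elements of `SV` vanish in sufficiently high degrees. -/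
theorem pow_apply_eventually_zero {Φ : Antidual V} (h : Φ 1 = 0) (θ : Sym V) :
    ∃ N, ∀ n, N ≤ n → (Φ ^ n) θ = 0 := by
  have key : ∀ a θ : Sym V, (∀ Ψ : Antidual V, ∃ N, ∀ n, N ≤ n → (Φ ^ n * Ψ) θ = 0) →
      ∀ Ψ : Antidual V, ∃ N, ∀ n, N ≤ n → (Φ ^ n * Ψ) (a * θ) = 0 := by
    intro a
    induction a using SymmetricAlgebra.induction with
    | algebraMap r =>
      intro θ hθ Ψ
      obtain ⟨N, hN⟩ := hθ Ψ
      refine ⟨N, fun n hn => ?_⟩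
      rw [← Algebra.smul_def, map_smulₛₗ, hN n hn, smul_zero]
    | ι v =>
      intro θ hθ Ψ
      obtain ⟨N, hN⟩ := hθ (annih v Φ * Ψ)
      obtain ⟨N', hN'⟩ := hθ (Φ * annih v Ψ)
      refine ⟨max N N' + 1, fun n hn => ?_⟩
      obtain ⟨n, rfl⟩ := Nat.exists_eq_succ_of_ne_zero (by omega : n ≠ 0)
      rw [← annih_apply, Nat.succ_eq_add_one, annih_pow_mul, LinearMap.add_apply,
        LinearMap.smul_apply, hN n (by omega), hN' n (by omega), smul_zero, add_zero]
    | mul a b ha hb =>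
      intro θ hθ
      rw [mul_assoc]
      exact ha _ (hb _ hθ)
    | add a b ha hb =>
      intro θ hθ Ψ
      obtain ⟨N, hN⟩ := ha θ hθ Ψ
      obtain ⟨N', hN'⟩ := hb θ hθ Ψ
      refine ⟨max N N', fun n hn => ?_⟩
      rw [add_mul, map_add, hN n (by omega), hN' n (by omega), add_zero]
  have h1 : ∀ Ψ : Antidual V, ∃ N, ∀ n, N ≤ n → (Φ ^ n * Ψ) 1 = 0 := fun Ψ =>
    ⟨1, fun n hn => by
      obtain ⟨n, rfl⟩ := Nat.exists_eq_succ_of_ne_zero (by omega : n ≠ 0)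
      rw [Nat.succ_eq_add_one, pow_succ', mul_assoc, apply_one_mul, h, zero_mul]⟩
  obtain ⟨N, hN⟩ := key θ 1 h1 1
  exact ⟨N, fun n hn => by simpa using hN n hn⟩

theorem summable_exp {Φ : Antidual V} (h : Φ 1 = 0) (θ : Sym V) :
    Summable fun n : ℕ => (n.factorial : ℂ)⁻¹ * (Φ ^ n) θ := by
  obtain ⟨N, hN⟩ := pow_apply_eventually_zero h θ
  refine summable_of_ne_finset_zero (s := Finset.range N) fun n hn => ?_
  rw [hN n (by simpa using hn), mul_zero]

/-- The exponential `∑ n, Φⁿ / n!` of an element `Φ` of `SV'` without constant term. The series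
converges weakly (that is, pointwise on `SV`). -/
def exp (Φ : Antidual V) (h : Φ 1 = 0) : Antidual V where
  toFun θ := ∑' n : ℕ, (n.factorial : ℂ)⁻¹ * (Φ ^ n) θ
  map_add' a b := by
    rw [← (summable_exp h a).tsum_add (summable_exp h b)]
    simp only [map_add, mul_add]
  map_smul' c a := by
    rw [smul_eq_mul, ← tsum_mul_left]
    simp only [map_smulₛₗ, smul_eq_mul, mul_left_comm]

/-- The Gaussian `e^Z = exp(ζ)`, where the quadratic `ζ` corresponds to `Z`. -/
def gaussian (Z : V →L⋆[ℂ] V) : Antidual V := exp (quadratic Z) (quadratic_one Z)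

/-! ### Determinants -/

/-- `A` is of trace class. -/
def IsTraceClass (A : V →L[ℂ] V) : Prop :=
  ∃ C : ℝ, ∀ (n : ℕ) (e f : Fin n → V), Orthonormal ℂ e → Orthonormal ℂ f →
    ∑ i, ‖(inner ℂ (e i) (A (f i)) : ℂ)‖ ≤ C

/-- The compression `P_M A|_M : M → M` of `A` to a finite-dimensional subspace `M`. -/
def compression (A : V →L[ℂ] V) (M : FinSub V) : M.1 →ₗ[ℂ] M.1 :=
  (M.1.orthogonalProjectionOnto ∘L A ∘L M.1.subtypeL).toLinearMap

/-- The Fredholm determinant `Det (I + A)`, for `A` of trace class, exists and has the value `D`: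
it is the limit of the determinants of the compressions of `I + A` to finite-dimensional subspaces
directed by inclusion. -/
def HasFredholmDet (A : V →L[ℂ] V) (D : ℂ) : Prop :=
  Filter.Tendsto (fun M : FinSub V => LinearMap.det (LinearMap.id + compression A M))
    Filter.atTop (nhds D)

/-- `w` is the value `Det^{1/2} (I - T)` of the square root of the Fredholm determinant, on the
branch that is obtained by continuation from the value `1` at `I` along the segment `I - tT`,
`0 ≤ t ≤ 1`. -/
def IsSqrtFredholmDet (T : V →L[ℂ] V) (w : ℂ) : Prop :=
  ∃ s : ℝ → ℂ, ContinuousOn s (Set.Icc 0 1) ∧ s 0 = 1 ∧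
    (∀ t ∈ Set.Icc (0 : ℝ) 1, HasFredholmDet (-((t : ℂ) • T)) (s t ^ 2)) ∧ s 1 = w

end BosonicFock
end

namespace BosonicFock
noncomputable section

open Filter Topology

/-! ### Power series and exponentials -/

/-! Everything is reduced to traces. On a finite-dimensional `M` with orthonormal frame `e`, let `G
d` be the inner product of the degree-`d` components of `e^X` and `e^Y`. Three facts determine these
numbers: the annihilator is a derivation with `a(v)e^Z = ⟨·|Zv⟩e^Z` (`annih_gaussian`); the number
operator `∑ a(e_i)* a(e_i)` equals `d + 1` in degree `d + 1` (`pair_succ`); multiplication by a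
vector is adjoint to the annihilator of its projection (`pair_vec_mul`). Moving vectors back and
forth between the two Gaussians gives `(d+1) G (d+1) = ∑ c_j G (d-j)`, where `c_(2k+1)` is the trace
of `(P_M Y P_M X)^(k+1)` on `M` and the even coefficients vanish (`pair_gaussian_succ`). This is the
Taylor recursion of the exponential of a power series, so `∑ G d = exp(½ ∑ tr_k / (k+1))`, with
`tr_k = c_(2k+1)`.

On the other side, `det(1 - tT) = exp(-∑ tr(T^(k+1)) t^(k+1) / (k+1))` for the compression `T` of
`YX` (`det_one_sub_eq_exp`). Its traces involve `P_M Y X` instead of `P_M Y P_M X`, so the two sides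
need not agree on `M`. Written as Hilbert–Schmidt inner products, however, both families of traces
tend to the trace of `(YX)^(k+1)` (`trace_limit`), with geometric bounds uniform in `M`
(`norm_trace_le`). Dominated convergence then yields one function `L` that governs both limits
(`exists_traceSeries`).

Finally, the norms on the subspaces `M` increase with `M`, so the supremum that defines the Fock
norm is a limit, and polarization gives the inner product as a limit too
(`fockInner_eq_of_tendsto`). The continuous square root of the determinant must be `exp(-L(t)/2)`.
-/

/-- The logarithmic series `∑ c_j z^(j+1) / (j+1)`, the primitive of `∑ c_j z^j`. -/
def primSeries (c : ℕ → ℂ) (z : ℂ) : ℂ := ∑' j : ℕ, c j * z ^ (j + 1) / ((j + 1 : ℕ) : ℂ)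

theorem summable_geometric_bound {r R : ℝ} (C : ℝ) (hr : 0 ≤ r) (hR : 0 ≤ R) (hrR : r * R < 1) :
    Summable fun j : ℕ => C * (r * R) ^ j :=
  (summable_geometric_of_lt_one (mul_nonneg hr hR) hrR).mul_left C

theorem norm_term_le {c : ℕ → ℂ} {C r R : ℝ}
    (hc : ∀ j, ‖c j‖ ≤ C * r ^ j) {z : ℂ} (hz : ‖z‖ ≤ R) (j : ℕ) :
    ‖c j * z ^ j‖ ≤ C * (r * R) ^ j := by
  rw [norm_mul, norm_pow, mul_pow, ← mul_assoc]
  have := hc j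
  gcongr
  exact (norm_nonneg _).trans this

theorem norm_primSeries_term_le {c : ℕ → ℂ} {C r R : ℝ}
    (hc : ∀ j, ‖c j‖ ≤ C * r ^ j) {z : ℂ} (hz : ‖z‖ ≤ R) (j : ℕ) :
    ‖c j * z ^ (j + 1) / ((j + 1 : ℕ) : ℂ)‖ ≤ R * (C * (r * R) ^ j) := by
  have h1 := norm_term_le hc hz j
  have h2 : (1 : ℝ) ≤ ((j + 1 : ℕ) : ℝ) := by norm_cast; omega
  have hR : 0 ≤ R := (norm_nonneg z).trans hz
  rw [norm_div, RCLike.norm_natCast, pow_succ, ← mul_assoc, norm_mul]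
  refine (div_le_self (by positivity) h2).trans ?_
  rw [mul_comm]
  gcongr

/-- Termwise differentiation. Only `r * R < 1` is required, so `R` may exceed `1` and the point `1`
becomes interior. -/
theorem hasDerivAt_primSeries {c : ℕ → ℂ} {C r R : ℝ} (hr : 0 ≤ r) (hrR : r * R < 1)
    (hc : ∀ j, ‖c j‖ ≤ C * r ^ j) {z : ℂ} (hz : z ∈ Metric.ball (0 : ℂ) R) :
    HasDerivAt (primSeries c) (∑' j, c j * z ^ j) z := by
  have hR : 0 < R := Metric.pos_of_mem_ball hz
  refine hasDerivAt_tsum_of_isPreconnected (summable_geometric_bound C hr hR.le hrR)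
    Metric.isOpen_ball (convex_ball (0 : ℂ) R).isPreconnected
    (g' := fun j y => c j * y ^ j) (fun j y _ => ?_) (fun j y hy => ?_)
    (Metric.mem_ball_self hR) ?_ hz
  · have hj : (((j + 1 : ℕ) : ℂ)) ≠ 0 := Nat.cast_ne_zero.2 (Nat.succ_ne_zero j)
    have h := ((hasDerivAt_pow (j + 1) y).const_mul (c j)).div_const ((j + 1 : ℕ) : ℂ)
    convert! h using 1
    rw [Nat.add_sub_cancel]
    field_simp
  · exact norm_term_le hc (by simpa using (Metric.mem_ball.1 hy).le) j
  · simp [summable_zero]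

theorem iteratedDeriv_eq_of_hasSum {f : ℂ → ℂ} {c : ℕ → ℂ}
    (h : ∀ᶠ z in 𝓝 (0 : ℂ), HasSum (fun j => c j * z ^ j) (f z)) (n : ℕ) :
    iteratedDeriv n f 0 = (n.factorial : ℂ) * c n := by
  have h1 : HasFPowerSeriesAt f (FormalMultilinearSeries.ofScalars ℂ c) 0 := by
    rw [hasFPowerSeriesAt_iff]
    filter_upwards [h] with z hz
    simpa [FormalMultilinearSeries.coeff_ofScalars, mul_comm] using hz
  have h2 := h1.eq_formalMultilinearSeries h1.analyticAt.hasFPowerSeriesAt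
  have h3 := congrArg (fun p => FormalMultilinearSeries.coeff p n) h2
  simp only [FormalMultilinearSeries.coeff_ofScalars] at h3
  rw [h3, mul_div_cancel₀ _ (Nat.cast_ne_zero.2 n.factorial_ne_zero)]

/-- A sequence that satisfies the recursion of the Taylor coefficients of the exponential of a
power series sums up to the value of this exponential at `1`. -/
theorem hasSum_of_recursion {c G : ℕ → ℂ} {C r : ℝ} (hr : 0 ≤ r) (hr1 : r < 1)
    (hc : ∀ j, ‖c j‖ ≤ C * r ^ j) (h0 : G 0 = 1)
    (hG : ∀ d : ℕ, ((d + 1 : ℕ) : ℂ) * G (d + 1) = ∑ j ∈ Finset.range (d + 1), c j * G (d - j)) :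
    HasSum G (Complex.exp (primSeries c 1)) := by
  -- A radius beyond `1` but inside the disc of convergence; this makes the Taylor series at `0`
  -- converge at `1`.
  obtain ⟨R, hR1, hrR⟩ : ∃ R : ℝ, 1 < R ∧ r * R < 1 := by
    refine ⟨2 / (1 + r), ?_, ?_⟩
    · rw [lt_div_iff₀ (by linarith)]; linarith
    · rw [mul_div_assoc', div_lt_one (by linarith)]; linarith
  let F : ℂ → ℂ := fun z => Complex.exp (primSeries c z)
  let φ : ℂ → ℂ := fun z => ∑' j, c j * z ^ j
  have hF : ∀ z ∈ Metric.ball (0 : ℂ) R, HasDerivAt F (φ z * F z) z := fun z hz => by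
    simpa [mul_comm] using (hasDerivAt_primSeries hr hrR hc hz).cexp
  have hball : Metric.ball (0 : ℂ) R ∈ 𝓝 (0 : ℂ) := Metric.ball_mem_nhds _ (by linarith)
  have hφ : ∀ᶠ z in 𝓝 (0 : ℂ), HasSum (fun j => c j * z ^ j) (φ z) := by
    filter_upwards [hball] with z hz
    exact (Summable.of_norm_bounded (summable_geometric_bound C hr (by linarith) hrR)
      fun j => norm_term_le hc (by simpa using (Metric.mem_ball.1 hz).le) j).hasSum
  have hdF : DifferentiableOn ℂ F (Metric.ball 0 R) := fun z hz =>
    (hF z hz).differentiableAt.differentiableWithinAt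
  have hFan : AnalyticAt ℂ F 0 := hdF.analyticAt hball
  have hφan : AnalyticAt ℂ φ 0 := by
    have h1 : HasFPowerSeriesAt φ (FormalMultilinearSeries.ofScalars ℂ c) 0 := by
      rw [hasFPowerSeriesAt_iff]
      filter_upwards [hφ] with z hz
      simpa [FormalMultilinearSeries.coeff_ofScalars, mul_comm] using hz
    exact h1.analyticAt
  have hF0 : F 0 = 1 := by simp [F, primSeries]
  -- `F' = φF`, so Leibniz's rule yields the given recursion for the Taylor coefficients of `F`.
  have hrec : ∀ n, iteratedDeriv (n + 1) F 0 = ∑ j ∈ Finset.range (n + 1),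
      (n.choose j : ℂ) * ((j.factorial : ℂ) * c j) * iteratedDeriv (n - j) F 0 := fun n => by
    have h1 : deriv F =ᶠ[𝓝 0] φ * F := by
      filter_upwards [hball] with z hz using (hF z hz).deriv
    rw [iteratedDeriv_succ', h1.iteratedDeriv_eq n,
      iteratedDeriv_mul hφan.contDiffAt hFan.contDiffAt]
    exact Finset.sum_congr rfl fun j _ => by rw [iteratedDeriv_eq_of_hasSum hφ]
  have hcoef : ∀ n, iteratedDeriv n F 0 = (n.factorial : ℂ) * G n := by
    intro n
    induction n using Nat.strong_induction_on with
    | _ n ih =>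
      match n with
      | 0 => simp [hF0, h0]
      | n + 1 =>
        rw [hrec, Nat.factorial_succ, Nat.cast_mul, mul_comm ((n + 1 : ℕ) : ℂ), mul_assoc, hG,
          Finset.mul_sum]
        refine Finset.sum_congr rfl fun j hj => ?_
        have hj' : j ≤ n := by simpa [Nat.lt_succ_iff] using hj
        rw [ih (n - j) (by omega), ← Nat.choose_mul_factorial_mul_factorial hj']
        push_cast
        ring
  have h1 : (1 : ℂ) ∈ Metric.ball (0 : ℂ) R := by simpa using hR1
  have := Complex.hasSum_taylorSeries_on_ball hdF h1
  convert! this using 2 with n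
  have hn : (n.factorial : ℂ) ≠ 0 := Nat.cast_ne_zero.2 n.factorial_ne_zero
  simp [hcoef, hn]

/-! ### Determinants and traces -/

section Det

variable {E : Type*} [NormedAddCommGroup E] [NormedSpace ℂ E] [FiniteDimensional ℂ E]

-- `det(1 + hS)` is a polynomial in `h` whose linear coefficient is the trace.
open Polynomial in
theorem hasDerivAt_det_one_add (S : E →ₗ[ℂ] E) :
    HasDerivAt (fun h : ℂ => LinearMap.det (1 + h • S)) (LinearMap.trace ℂ E S) 0 := by
  let b := Module.finBasis ℂ E
  let M := LinearMap.toMatrix b b S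
  have h1 : ∀ h : ℂ, LinearMap.det (1 + h • S) =
      ((1 + (X : ℂ[X]) • M.map C).det).eval h := fun h => by
    rw [← LinearMap.det_toMatrix b, ← Polynomial.coe_evalRingHom, RingHom.map_det, map_add,
      map_smul, LinearMap.toMatrix_one]
    congr 1
    ext i j
    simp [M, Matrix.one_apply, apply_ite, mul_comm h]
  have h2 := ((1 + (X : ℂ[X]) • M.map C).det).hasDerivAt 0
  rw [Matrix.derivative_det_one_add_X_smul, ← LinearMap.trace_eq_matrix_trace] at h2
  exact h2.congr_of_eventuallyEq (Eventually.of_forall h1)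

variable [CompleteSpace E]

/-- The determinant of `1 - T` as the exponential of a series of traces. -/
theorem det_one_sub_eq_exp (T : E →L[ℂ] E) (hT : ‖T‖ < 1) :
    LinearMap.det ((1 - T : E →L[ℂ] E) : E →ₗ[ℂ] E) =
      Complex.exp (-primSeries
        (fun k => LinearMap.trace ℂ E ((T ^ (k + 1) : E →L[ℂ] E) : E →ₗ[ℂ] E)) 1) := by
  let tr : (E →L[ℂ] E) →L[ℂ] ℂ :=
    LinearMap.toContinuousLinearMap ((LinearMap.trace ℂ E).comp (ContinuousLinearMap.coeLM ℂ))
  set c : ℕ → ℂ := fun k => tr (T ^ (k + 1)) with hcdef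
  change _ = Complex.exp (-primSeries c 1)
  have hc : ∀ j, ‖c j‖ ≤ ‖tr‖ * ‖T‖ * ‖T‖ ^ j := fun j => by
    refine (tr.le_opNorm _).trans ?_
    rw [mul_assoc, ← pow_succ']
    gcongr
    exact norm_pow_le' T (Nat.succ_pos j)
  obtain ⟨R, hR1, hrR⟩ : ∃ R : ℝ, 1 < R ∧ ‖T‖ * R < 1 := by
    refine ⟨2 / (1 + ‖T‖), ?_, ?_⟩
    · rw [lt_div_iff₀ (by positivity)]; linarith
    · rw [mul_div_assoc', div_lt_one (by positivity)]; linarith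
  let D : ℂ → ℂ := fun t => LinearMap.det ((1 - t • T : E →L[ℂ] E) : E →ₗ[ℂ] E)
  have hD : ∀ t ∈ Metric.ball (0 : ℂ) R, HasDerivAt D (-(∑' j, c j * t ^ j) * D t) t := by
    intro t ht
    have ht' : ‖t • T‖ < 1 := by
      rw [norm_smul, mul_comm]
      refine lt_of_le_of_lt ?_ hrR
      gcongr
      simpa using (Metric.mem_ball.1 ht).le
    -- The Neumann series inverts `1 - tT`; the logarithmic derivative of `D` at `t` is `-tr(S T)`,
    -- which expands as `-∑ c_j t^j`.
    let S : E →L[ℂ] E := ∑' n : ℕ, (t • T) ^ n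
    have hS : (1 - t • T) * S = 1 := mul_neg_geom_series (t • T) ht'
    have htr : (∑' j, c j * t ^ j) = tr (S * T) := by
      have h1 : HasSum (fun n : ℕ => (t • T) ^ n) S :=
        (summable_geometric_of_norm_lt_one ht').hasSum
      have h2 := (h1.mul_right T).mapL tr
      rw [← h2.tsum_eq]
      refine tsum_congr fun j => ?_
      rw [smul_pow, smul_mul_assoc, ← pow_succ, map_smul, smul_eq_mul, mul_comm]
    -- Multiplicativity of `det` carries the derivative at the identity to the base point `t`.
    have hmul : ∀ u : ℂ, D u = D t *
        LinearMap.det (1 + (u - t) • (-(S * T) : E →L[ℂ] E).toLinearMap) := by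
      intro u
      have : (1 - u • T : E →L[ℂ] E) = (1 - t • T) * (1 + (u - t) • (-(S * T))) := by
        rw [mul_add, mul_one, mul_smul_comm, mul_neg, ← mul_assoc, hS, one_mul, sub_smul]
        simp only [smul_neg]
        abel
      change LinearMap.det _ = _
      rw [this]
      exact LinearMap.det.map_mul _ _
    have h3 : HasDerivAt (fun u : ℂ => LinearMap.det
        (1 + (u - t) • (-(S * T) : E →L[ℂ] E).toLinearMap)) (tr (-(S * T))) t := by
      have h5 := hasDerivAt_det_one_add (-(S * T) : E →L[ℂ] E).toLinearMap
      rw [← sub_self t] at h5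
      exact h5.comp_sub_const t t
    have h4 : HasDerivAt D (D t * tr (-(S * T))) t :=
      (h3.const_mul (D t)).congr_of_eventuallyEq (Eventually.of_forall hmul)
    rw [htr]
    convert! h4 using 1
    rw [map_neg, mul_comm]
  have hP : ∀ t ∈ Metric.ball (0 : ℂ) R,
      HasDerivAt (fun t => D t * Complex.exp (primSeries c t)) 0 t := fun t ht => by
    convert! (hD t ht).mul (hasDerivAt_primSeries (norm_nonneg T) hrR hc ht).cexp using 1
    ring
  have h1 : (1 : ℂ) ∈ Metric.ball (0 : ℂ) R := by simpa using hR1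
  have hconst := (Metric.isOpen_ball (x := (0 : ℂ)) (ε := R)).is_const_of_deriv_eq_zero (𝕜 := ℂ)
    (f := fun t => D t * Complex.exp (primSeries c t))
    (convex_ball (0 : ℂ) R).isPreconnected
    (fun t ht => (hP t ht).differentiableAt.differentiableWithinAt)
    (fun t ht => (hP t ht).deriv) h1 (Metric.mem_ball_self (by linarith))
  have h0 : D 0 * Complex.exp (primSeries c 0) = 1 := by
    simp [D, primSeries]
  simp only [h0] at hconst
  rw [Complex.exp_neg, ← eq_inv_of_mul_eq_one_left hconst]
  simp [D]

theorem det_one_sub_smul_eq_exp (T : E →L[ℂ] E) {t : ℂ} (ht : ‖t‖ * ‖T‖ < 1) :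
    LinearMap.det ((1 - t • T : E →L[ℂ] E) : E →ₗ[ℂ] E) =
      Complex.exp (-primSeries (fun k => LinearMap.trace ℂ E ((T : E →ₗ[ℂ] E) ^ (k + 1))) t) := by
  rw [det_one_sub_eq_exp (t • T) (by rwa [norm_smul]), primSeries, primSeries]
  congr 2
  refine tsum_congr fun k => ?_
  have h : (((t • T) ^ (k + 1) : E →L[ℂ] E) : E →ₗ[ℂ] E) =
      t ^ (k + 1) • (T : E →ₗ[ℂ] E) ^ (k + 1) := by
    rw [smul_pow, ← ContinuousLinearMap.toLinearMap_pow]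
    rfl
  rw [h, map_smul, smul_eq_mul, one_pow, mul_one, mul_comm]

end Det

variable {V : Type*} [NormedAddCommGroup V] [InnerProductSpace ℂ V]

/-! ### Annihilators and Gaussians -/

theorem annih_comm (v w : V) (Φ : Antidual V) : annih v (annih w Φ) = annih w (annih v Φ) := by
  ext θ
  simp only [annih_apply, mul_left_comm]

theorem annih_smul_vec (c : ℂ) (v : V) (Φ : Antidual V) :
    annih (c • v) Φ = conj c • annih v Φ := by
  ext θ
  simp [annih_apply]

theorem annih_sum_vec {ι : Type*} (s : Finset ι) (v : ι → V) (Φ : Antidual V) :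
    annih (∑ i ∈ s, v i) Φ = ∑ i ∈ s, annih (v i) Φ := by
  ext θ
  simp [annih_apply, Finset.sum_mul, LinearMap.sum_apply]

theorem annih_vec_mul (v w : V) (Ψ : Antidual V) :
    annih v (vec w * Ψ) = (inner ℂ v w : ℂ) • Ψ + vec w * annih v Ψ := by
  rw [annih_mul, annih_vec, smul_mul_assoc, one_mul]

theorem vec_apply_one (w : V) : vec w (1 : Sym V) = 0 := by
  change inner ℂ (linPart 1) w = 0
  simp

/-- Multiplication in `SV'` is weakly continuous in each factor. -/
theorem hasSum_mul_apply {ι : Type*} (Φ : Antidual V) {Ψ : ι → Antidual V} {Ψ' : Antidual V}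
    (h : ∀ θ, HasSum (fun n => Ψ n θ) (Ψ' θ)) (θ : Sym V) :
    HasSum (fun n => (Φ * Ψ n) θ) ((Φ * Ψ') θ) := by
  simp only [mul_apply]
  induction Coalgebra.comul (R := ℂ) θ using TensorProduct.induction_on with
  | zero => simp [hasSum_zero]
  | tmul a b => simpa using (h b).mul_left (Φ a)
  | add x y hx hy => simpa using hx.add hy

theorem hasSum_gaussian (Z : V →L⋆[ℂ] V) (θ : Sym V) :
    HasSum (fun n : ℕ => ((n.factorial : ℂ)⁻¹ • quadratic Z ^ n) θ) (gaussian Z θ) :=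
  (summable_exp (quadratic_one Z) θ).hasSum

theorem annih_quadratic_pow {Z : V →L⋆[ℂ] V} (hZ : IsSymm Z) (v : V) (n : ℕ) :
    annih v (quadratic Z ^ (n + 1)) = ((n + 1 : ℕ) : ℂ) • (vec (Z v) * quadratic Z ^ n) := by
  have h := annih_pow_mul v (quadratic Z) 1 n
  rw [mul_one, annih_one, mul_zero, mul_zero, add_zero, mul_one, annih_quadratic hZ] at h
  rw [h, mul_comm]

/-- The chain rule for a derivation applied to `exp(ζ)`, with `a(v)ζ = ⟨·|Zv⟩`. The constant term of
the series is killed, and the index shift absorbs the factor `n + 1`. -/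
theorem annih_gaussian {Z : V →L⋆[ℂ] V} (hZ : IsSymm Z) (v : V) :
    annih v (gaussian Z) = vec (Z v) * gaussian Z := by
  ext θ
  have h1 := hasSum_mul_apply (vec (Z v)) (hasSum_gaussian Z) θ
  have h2 := hasSum_gaussian Z (inc v * θ)
  rw [← hasSum_nat_add_iff' 1] at h2
  have h3 : gaussian Z (inc v * θ) - ∑ i ∈ Finset.range 1,
      ((i.factorial : ℂ)⁻¹ • quadratic Z ^ i) (inc v * θ) = annih v (gaussian Z) θ := by
    simp [annih_apply, one_apply, Bialgebra.counit_mul]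
  rw [h3] at h2
  refine h2.unique ?_
  convert! h1 using 2 with n
  rw [← annih_apply, map_smul, annih_quadratic_pow hZ, smul_smul, mul_smul_comm]
  congr 2
  rw [Nat.factorial_succ, Nat.cast_mul, mul_inv_rev, mul_assoc,
    inv_mul_cancel₀ (Nat.cast_ne_zero.2 n.succ_ne_zero), mul_one]

theorem gaussian_one (Z : V →L⋆[ℂ] V) : gaussian Z 1 = 1 := by
  have h := hasSum_gaussian Z 1
  refine h.unique ?_
  convert! hasSum_ite_eq (0 : ℕ) (1 : ℂ) using 2 with n
  cases n with
  | zero => simp [one_apply]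
  | succ n =>
    rw [LinearMap.smul_apply, pow_succ, apply_one_mul, quadratic_one]
    simp

/-! ### The inner product on a finite-dimensional subspace -/

/-- For an orthonormal basis `e` of `M`, the inner product of `Φ_M^d` and `Ψ_M^d`. -/
def pair {m : ℕ} (e : Fin m → V) (d : ℕ) (Φ Ψ : Antidual V) : ℂ :=
  (d.factorial : ℂ)⁻¹ * ∑ f : Fin d → Fin m, conj (Φ (monom e f)) * Ψ (monom e f)

section Pair

variable {m : ℕ} (e : Fin m → V) (d : ℕ)

theorem pair_add_right (Φ Ψ Ψ' : Antidual V) :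
    pair e d Φ (Ψ + Ψ') = pair e d Φ Ψ + pair e d Φ Ψ' := by
  simp [pair, mul_add, Finset.sum_add_distrib]

theorem pair_smul_right (c : ℂ) (Φ Ψ : Antidual V) :
    pair e d Φ (c • Ψ) = c * pair e d Φ Ψ := by
  simp only [pair, LinearMap.smul_apply, smul_eq_mul, mul_left_comm _ c, ← Finset.mul_sum]

theorem pair_conj (Φ Ψ : Antidual V) : conj (pair e d Φ Ψ) = pair e d Ψ Φ := by
  simp [pair, map_sum, mul_comm]

theorem pair_add_left (Φ Φ' Ψ : Antidual V) :
    pair e d (Φ + Φ') Ψ = pair e d Φ Ψ + pair e d Φ' Ψ := by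
  simp only [← pair_conj e d Ψ, pair_add_right, map_add]

theorem pair_smul_left (c : ℂ) (Φ Ψ : Antidual V) :
    pair e d (c • Φ) Ψ = conj c * pair e d Φ Ψ := by
  simp only [← pair_conj e d Ψ, pair_smul_right, map_mul]

theorem pair_sum_left {ι : Type*} (s : Finset ι) (Φ : ι → Antidual V) (Ψ : Antidual V) :
    pair e d (∑ i ∈ s, Φ i) Ψ = ∑ i ∈ s, pair e d (Φ i) Ψ := by
  classical
  induction s using Finset.induction_on with
  | empty => simp [pair]
  | insert a s ha ih => rw [Finset.sum_insert ha, Finset.sum_insert ha, pair_add_left, ih]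

theorem pair_zero (Φ Ψ : Antidual V) : pair e 0 Φ Ψ = conj (Φ 1) * Ψ 1 := by
  simp [pair, monom]

/-- The number operator in coordinates: splitting off the first index of `f` turns evaluation on
`monom e f` into an annihilator, and `(d+1)!` supplies the factor. -/
theorem pair_succ (Φ Ψ : Antidual V) :
    ((d + 1 : ℕ) : ℂ) * pair e (d + 1) Φ Ψ =
      ∑ i, pair e d (annih (e i) Φ) (annih (e i) Ψ) := by
  have hd : ((d + 1 : ℕ) : ℂ) ≠ 0 := Nat.cast_ne_zero.2 d.succ_ne_zero
  rw [pair, Nat.factorial_succ, Nat.cast_mul, mul_inv, ← mul_assoc, ← mul_assoc,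
    mul_inv_cancel₀ hd, one_mul, ← (Fin.consEquiv fun _ => Fin m).sum_comp,
    Fintype.sum_prod_type, Finset.mul_sum]
  refine Finset.sum_congr rfl fun i _ => ?_
  simp [pair, annih_apply, monom, Fin.prod_univ_succ, Fin.consEquiv]

/-- The orthogonal projection on the span of an orthonormal family. -/
def frameProj (w : V) : V := ∑ j, (inner ℂ (e j) w : ℂ) • e j

theorem pair_annih_frameProj (w : V) (Φ Ψ : Antidual V) :
    pair e d (annih (frameProj e w) Φ) Ψ =
      ∑ j, (inner ℂ (e j) w : ℂ) * pair e d (annih (e j) Φ) Ψ := by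
  simp only [frameProj, annih_sum_vec, annih_smul_vec, pair_sum_left, pair_smul_left,
    Complex.conj_conj]

/-- Multiplication by a vector is adjoint to its annihilator. -/
theorem pair_vec_mul (w : V) (Φ Ψ : Antidual V) :
    pair e (d + 1) Φ (vec w * Ψ) = pair e d (annih (frameProj e w) Φ) Ψ := by
  induction d generalizing Φ Ψ with
  | zero =>
    have h := pair_succ e 0 Φ (vec w * Ψ)
    simp only [zero_add, Nat.cast_one, one_mul] at h
    rw [zero_add, h, pair_annih_frameProj]
    refine Finset.sum_congr rfl fun i _ => ?_
    rw [annih_vec_mul, pair_add_right, pair_smul_right, pair_zero e _ (vec w * _), apply_one_mul,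
      vec_apply_one, zero_mul, mul_zero, add_zero]
  | succ d ih =>
    have hd : ((d + 1 + 1 : ℕ) : ℂ) ≠ 0 := Nat.cast_ne_zero.2 (d + 1).succ_ne_zero
    refine mul_left_cancel₀ hd ?_
    -- After Leibniz's rule, the terms `⟨e_i|w⟩` contribute the right-hand side once and the
    -- induction hypothesis contributes it `d + 1` times.
    rw [pair_succ]
    simp only [annih_vec_mul, pair_add_right, pair_smul_right, Finset.sum_add_distrib, ih]
    rw [← pair_annih_frameProj]
    simp only [annih_comm (frameProj e w)]
    have h := pair_succ e d (annih (frameProj e w) Φ) Ψ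
    simp only [annih_comm (e _) (frameProj e w)] at h
    simp only [annih_comm (e _) (frameProj e w), ← h]
    push_cast
    ring

theorem pair_vec_mul_left (w : V) (Φ Ψ : Antidual V) :
    pair e (d + 1) (vec w * Φ) Ψ = pair e d Φ (annih (frameProj e w) Ψ) := by
  rw [← pair_conj, pair_vec_mul, pair_conj]

end Pair

/-! ### The inner product of two Gaussians on a finite-dimensional subspace -/

section GaussianPair

variable {m : ℕ} (e : Fin m → V) {X Y : V →L⋆[ℂ] V}

/-- `a(w)e^X` is `Xw` times `e^X`. Applying `a(u)` leaves a scalar term plus `Xw · a(u)e^X`. The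
factor `Xw` crosses to `e^Y` as an annihilator, where it produces the factor `YPXw`; this crosses
back as the annihilator of `PYPXw`. Thus `w` is replaced by `PYPXw` at the cost of two degrees,
which is why only even `j` occur. -/
theorem pair_gaussian_annih_annih (hX : IsSymm X) (hY : IsSymm Y) (d : ℕ) (u w : V) :
    pair e d (annih u (annih w (gaussian X))) (gaussian Y) =
      ∑ j ∈ Finset.range (d + 1), (if Even j then
        (inner ℂ (X ((fun v => frameProj e (Y (frameProj e (X v))))^[j / 2] w)) u : ℂ) else 0) *
          pair e (d - j) (gaussian X) (gaussian Y) := by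
  have h1 : ∀ d u w, pair e d (annih u (annih w (gaussian X))) (gaussian Y) =
      (inner ℂ (X w) u : ℂ) * pair e d (gaussian X) (gaussian Y) +
        pair e d (vec (X w) * annih u (gaussian X)) (gaussian Y) := fun d u w => by
    rw [annih_gaussian hX w, annih_vec_mul, pair_add_left, pair_smul_left, inner_conj_symm]
  induction d using Nat.twoStepInduction generalizing u w with
  | zero => simp [h1, pair_zero, apply_one_mul, vec_apply_one]
  | one =>
    rw [h1, pair_vec_mul_left, annih_gaussian hY, Finset.sum_range_succ, Finset.sum_range_one]
    simp [pair_zero, apply_one_mul, vec_apply_one]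
  | more d ih _ =>
    rw [h1, pair_vec_mul_left, annih_gaussian hY, pair_vec_mul, annih_comm, ih,
      Finset.sum_range_succ' _ (d + 2), Finset.sum_range_succ' _ (d + 1)]
    have hdiv : ∀ j : ℕ, (j + 1 + 1) / 2 = j / 2 + 1 := fun j => by omega
    have hsub : ∀ j : ℕ, d + 2 - (j + 1 + 1) = d - j := fun j => by omega
    simp [hdiv, hsub, Nat.even_add_one, Function.iterate_succ_apply]
    ring

/-- The traces that occur in the recursion for the inner products of two Gaussians. -/
def frameTrace (X Y : V →L⋆[ℂ] V) (k : ℕ) : ℂ :=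
  ∑ i, inner ℂ (X ((fun v => frameProj e (Y (frameProj e (X v))))^[k] (e i)))
    (frameProj e (Y (e i)))

/-- The coefficients of the recursion for the inner products of two Gaussians. -/
def frameCoeff (p : ℕ → ℂ) (j : ℕ) : ℂ := if Odd j then p (j / 2) else 0

/-- The number operator produces `a(e_i)e^Y = Y e_i · e^Y`; moving `Y e_i` across costs one degree
and leaves the previous expansion with `w = e_i` and `u = PY e_i`. The lost degree turns even
indices into odd ones. -/
theorem pair_gaussian_succ (hX : IsSymm X) (hY : IsSymm Y) (d : ℕ) :
    ((d + 1 : ℕ) : ℂ) * pair e (d + 1) (gaussian X) (gaussian Y) =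
      ∑ j ∈ Finset.range (d + 1), frameCoeff (frameTrace e X Y) j *
        pair e (d - j) (gaussian X) (gaussian Y) := by
  rw [pair_succ]
  simp only [annih_gaussian hY]
  cases d with
  | zero => simp [pair_zero, apply_one_mul, vec_apply_one, frameCoeff]
  | succ d =>
    simp only [pair_vec_mul, pair_gaussian_annih_annih e hX hY]
    rw [Finset.sum_comm, Finset.sum_range_succ' _ (d + 1)]
    have hdiv : ∀ j : ℕ, Even j → (j + 1) / 2 = j / 2 := fun j hj => by
      obtain ⟨k, rfl⟩ := hj
      omega
    have hfz : frameCoeff (frameTrace e X Y) 0 = 0 := by simp [frameCoeff]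
    rw [hfz, zero_mul, add_zero]
    refine Finset.sum_congr rfl fun j _ => ?_
    rw [← Finset.sum_mul, Nat.add_sub_add_right]
    congr 1
    by_cases hj : Even j
    · simp [frameCoeff, hj, hdiv j hj, frameTrace]
    · simp [frameCoeff, Nat.odd_add_one, hj]

/-- The origin of the square root: only `j = 2k + 1` contributes, and then the denominator `j + 1`
is `2(k + 1)`. -/
theorem primSeries_frameCoeff (p : ℕ → ℂ) :
    primSeries (frameCoeff p) 1 = (1 / 2 : ℂ) * primSeries p 1 := by
  have hinj : Function.Injective fun k : ℕ => 2 * k + 1 := fun a b h => by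
    simpa using h
  rw [primSeries, primSeries, ← hinj.tsum_eq, ← tsum_mul_left]
  · refine tsum_congr fun k => ?_
    have h2 : (2 * k + 1) / 2 = k := by omega
    have h3 : Odd (2 * k + 1) := odd_two_mul_add_one k
    simp only [frameCoeff, h2, h3, if_true, one_pow, mul_one]
    push_cast
    rw [show (2 * (k : ℂ) + 1 + 1) = 2 * (k + 1) by ring, div_mul_div_comm, one_mul]
  · intro j hj
    by_contra hj'
    refine hj ?_
    have : ¬ Odd j := fun ⟨k, hk⟩ => hj' ⟨k, hk.symm⟩
    simp [frameCoeff, this]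

/-- At `j = 2k + 1` one has `H (r²)^k = (H / r) r^j`. -/
theorem norm_frameCoeff_le {p : ℕ → ℂ} {H r : ℝ} (hr : 0 < r) (hp : ∀ k, ‖p k‖ ≤ H * (r ^ 2) ^ k)
    (j : ℕ) : ‖frameCoeff p j‖ ≤ H / r * r ^ j := by
  have hH : 0 ≤ H := by simpa using (norm_nonneg _).trans (hp 0)
  rw [frameCoeff]
  split_ifs with h
  · obtain ⟨k, rfl⟩ := h
    have h2 : (2 * k + 1) / 2 = k := by omega
    rw [h2]
    refine (hp k).trans (le_of_eq ?_)
    rw [← pow_mul, pow_succ r (2 * k)]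
    field_simp
  · rw [norm_zero]; positivity

theorem hasSum_pair_gaussian (hX : IsSymm X) (hY : IsSymm Y) {H r : ℝ} (hr : 0 < r) (hr1 : r < 1)
    (hp : ∀ k, ‖frameTrace e X Y k‖ ≤ H * (r ^ 2) ^ k) :
    HasSum (fun d => pair e d (gaussian X) (gaussian Y))
      (Complex.exp ((1 / 2 : ℂ) * primSeries (frameTrace e X Y) 1)) := by
  rw [← primSeries_frameCoeff]
  refine hasSum_of_recursion hr.le hr1 (norm_frameCoeff_le hr hp) ?_ (pair_gaussian_succ e hX hY)
  simp [pair_zero, gaussian_one]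

end GaussianPair

/-! ### The norm on a finite-dimensional subspace -/

/-- An orthonormal basis of a finite-dimensional subspace, as a family of vectors of `V`. -/
def frame (M : FinSub V) : Fin (Module.finrank ℂ M.1) → V := fun i => stdOrthonormalBasis ℂ M.1 i

theorem orthonormal_frame (M : FinSub V) : Orthonormal ℂ (frame M) :=
  (stdOrthonormalBasis ℂ M.1).orthonormal.comp_linearIsometry M.1.subtypeₗᵢ

theorem span_orthonormalBasis {ι : Type*} [Fintype ι] (M : Submodule ℂ V)
    (b : OrthonormalBasis ι ℂ M) :
    Submodule.span ℂ (Set.range fun i => (b i : V)) = M := by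
  have h := congrArg (Submodule.map M.subtype) b.toBasis.span_eq
  rw [Submodule.map_span, Submodule.map_top, Submodule.range_subtype, ← Set.range_comp] at h
  simpa [Function.comp_def] using h

theorem span_frame (M : FinSub V) : Submodule.span ℂ (Set.range (frame M)) = M.1 :=
  span_orthonormalBasis M.1 _

/-- Any orthonormal frame of `M` may be used, so the frame can be adapted to a smaller subspace. -/
theorem symInner_component {m : ℕ} {e : Fin m → V} (he : Orthonormal ℂ e) (M : FinSub V)
    (hspan : Submodule.span ℂ (Set.range e) = M.1) (d : ℕ) (Φ : Antidual V) :
    symInner (component M.1 d Φ) (component M.1 d Φ) = pair e d Φ Φ := by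
  have hd : (d.factorial : ℂ) ≠ 0 := Nat.cast_ne_zero.2 d.factorial_ne_zero
  have hS := symPow_eq_span (d := d) M.1 e hspan
  have hmem : ∀ f : Fin d → Fin m, monom e f ∈ symPow M.1 d := fun f => by
    rw [hS]
    exact Submodule.subset_span ⟨f, rfl⟩
  -- The factor `1/d!` offsets the sum over permutations in the inner product of monomials.
  let φ : Sym V := ∑ f : Fin d → Fin m, ((d.factorial : ℂ)⁻¹ * Φ (monom e f)) • monom e f
  have hφ : φ ∈ symPow M.1 d :=
    Submodule.sum_mem _ fun f _ => Submodule.smul_mem _ _ (hmem f)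
  have hrep : ∀ ψ ∈ symPow M.1 d, Φ ψ = symInner ψ φ := by
    intro ψ hψ
    rw [hS] at hψ
    induction hψ using Submodule.span_induction with
    | mem x hx =>
      obtain ⟨g, rfl⟩ := hx
      have h := sum_symInner_smul' he (fun f => Φ (monom e f))
        (fun f π => by rw [monom_comp_perm]) g
      have h2 : symInner (monom e g) φ = (d.factorial : ℂ)⁻¹ *
          ∑ f : Fin d → Fin m, symInner (monom e g) (monom e f) • Φ (monom e f) := by
        simp only [φ, symInner, map_sum, map_smul, LinearMap.sum_apply, LinearMap.smul_apply,
          smul_eq_mul, Finset.mul_sum]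
        exact Finset.sum_congr rfl fun f _ => by ring
      rw [h2, h, smul_eq_mul, inv_mul_cancel_left₀ hd]
    | zero => simp [symInner]
    | add x y _ _ hx hy => rw [map_add, hx, hy, symInner, symInner, symInner, map_add]
    | smul c x _ hx => rw [map_smulₛₗ, hx, symInner, symInner, map_smulₛₗ]
  have hcomp : component M.1 d Φ = φ :=
    (existsUnique_component M.1 d Φ).unique (existsUnique_component M.1 d Φ).choose_spec.1
      ⟨hφ, hrep⟩
  rw [hcomp, ← hrep φ hφ]
  simp only [φ, pair, map_sum, map_smulₛₗ, map_mul, smul_eq_mul, Finset.mul_sum]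
  refine Finset.sum_congr rfl fun f _ => ?_
  simp [mul_assoc]

theorem pair_self_re {m : ℕ} (e : Fin m → V) (d : ℕ) (Φ : Antidual V) :
    (pair e d Φ Φ).re = (d.factorial : ℝ)⁻¹ * ∑ f : Fin d → Fin m, ‖Φ (monom e f)‖ ^ 2 := by
  have h : pair e d Φ Φ =
      (((d.factorial : ℝ)⁻¹ * ∑ f : Fin d → Fin m, ‖Φ (monom e f)‖ ^ 2 : ℝ) : ℂ) := by
    simp [pair, Complex.conj_mul']
  rw [h, Complex.ofReal_re]

theorem pair_self_re_nonneg {m : ℕ} (e : Fin m → V) (d : ℕ) (Φ : Antidual V) :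
    0 ≤ (pair e d Φ Φ).re := by
  rw [pair_self_re]
  positivity

theorem pair_comp_re_le {m n : ℕ} (e : Fin n → V) {τ : Fin m → Fin n}
    (hτ : Function.Injective τ) (d : ℕ) (Φ : Antidual V) :
    (pair (e ∘ τ) d Φ Φ).re ≤ (pair e d Φ Φ).re := by
  rw [pair_self_re, pair_self_re]
  refine mul_le_mul_of_nonneg_left ?_ (by positivity)
  have h := Finset.sum_map Finset.univ
    ⟨fun f : Fin d → Fin m => τ ∘ f, hτ.comp_left⟩ (fun f => ‖Φ (monom e f)‖ ^ 2)
  refine (le_of_eq ?_).trans ((h.symm.le).trans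
    (Finset.sum_le_sum_of_subset_of_nonneg (Finset.subset_univ _) fun _ _ _ => by positivity))
  rfl

theorem normOn_eq {m : ℕ} {e : Fin m → V} (he : Orthonormal ℂ e) (M : FinSub V)
    (hspan : Submodule.span ℂ (Set.range e) = M.1) (Φ : Antidual V) :
    normOn M Φ = (∑' d, ENNReal.ofReal (pair e d Φ Φ).re) ^ (1 / 2 : ℝ) := by
  simp only [normOn, symInner_component he M hspan]

/-- A frame of `M` extends to an orthonormal basis of `N`; the sum over the larger index set only
gains nonnegative terms. -/
theorem normOn_mono (Φ : Antidual V) : Monotone fun M : FinSub V => normOn M Φ := by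
  intro M N hMN
  have hMN' : M.1 ≤ N.1 := hMN
  let v : Fin (Module.finrank ℂ M.1) → N.1 := fun i =>
    ⟨frame M i, hMN' (stdOrthonormalBasis ℂ M.1 i).2⟩
  have hv : Orthonormal ℂ v := by
    have := orthonormal_frame M
    rw [orthonormal_iff_ite] at this ⊢
    exact this
  obtain ⟨u, b, hu, hb⟩ := hv.toSubtypeRange.exists_orthonormalBasis_extension
  let b' := b.reindex u.equivFin
  let e : Fin u.card → V := fun i => b' i
  have he : Orthonormal ℂ e := b'.orthonormal.comp_linearIsometry N.1.subtypeₗᵢ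
  have hspan : Submodule.span ℂ (Set.range e) = N.1 := span_orthonormalBasis N.1 b'
  let τ : Fin (Module.finrank ℂ M.1) → Fin u.card := fun i =>
    u.equivFin ⟨v i, hu (Set.mem_range_self i)⟩
  have hτ : e ∘ τ = frame M := by
    funext i
    simp [e, τ, b', hb, v]
  have hτ' : Function.Injective τ := by
    have h := (orthonormal_frame M).linearIndependent.injective
    rw [← hτ] at h
    exact h.of_comp
  change normOn M Φ ≤ normOn N Φ
  rw [normOn_eq (orthonormal_frame M) M (span_frame M), normOn_eq he N hspan, ← hτ]
  refine ENNReal.rpow_le_rpow (ENNReal.tsum_le_tsum fun d => ENNReal.ofReal_le_ofReal ?_)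
    (by norm_num)
  exact pair_comp_re_le e hτ' d Φ

/-- Directedness makes `atTop` a proper filter, so that limits over subspaces are unique. -/
instance : IsDirectedOrder (FinSub V) :=
  ⟨fun M N => ⟨⟨M.1 ⊔ N.1, Submodule.finiteDimensional_sup M.1 N.1⟩,
    (le_sup_left : M.1 ≤ M.1 ⊔ N.1), (le_sup_right : N.1 ≤ M.1 ⊔ N.1)⟩⟩

instance : Nonempty (FinSub V) := ⟨⟨⊥, inferInstance⟩⟩

theorem normOn_eq_of_hasSum {M : FinSub V} {Φ : Antidual V} {a : ℂ}
    (h : HasSum (fun d => pair (frame M) d Φ Φ) a) : normOn M Φ = ENNReal.ofReal √a.re := by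
  have h1 := Complex.hasSum_re h
  have h2 : 0 ≤ a.re := h1.nonneg fun d => pair_self_re_nonneg _ d Φ
  rw [normOn_eq (orthonormal_frame M) M (span_frame M),
    ← ENNReal.ofReal_tsum_of_nonneg (fun d => pair_self_re_nonneg _ d Φ) h1.summable, h1.tsum_eq,
    ENNReal.ofReal_rpow_of_nonneg h2 (by norm_num), Real.sqrt_eq_rpow]

/-- The supremum of a monotone net is its limit. Nonnegativity of the limit allows the square root
to be squared away later. -/
theorem fockNorm_eq_of_tendsto {Φ : Antidual V} {a : FinSub V → ℂ} {A : ℂ}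
    (h : ∀ M, HasSum (fun d => pair (frame M) d Φ Φ) (a M)) (ha : Tendsto a atTop (𝓝 A)) :
    fockNorm Φ = ENNReal.ofReal √A.re ∧ 0 ≤ A.re := by
  have hre : Tendsto (fun M => (a M).re) atTop (𝓝 A.re) :=
    (Complex.continuous_re.tendsto A).comp ha
  constructor
  · refine tendsto_nhds_unique (tendsto_atTop_iSup (normOn_mono Φ)) ?_
    simp only [fun M => normOn_eq_of_hasSum (h M)]
    exact (ENNReal.continuous_ofReal.tendsto _).comp ((Real.continuous_sqrt.tendsto _).comp hre)
  · exact ge_of_tendsto' hre fun M =>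
      (Complex.hasSum_re (h M)).nonneg fun d => pair_self_re_nonneg _ d Φ

/-- The polarized inner product of `S[V]` is the limit of the inner products of components. -/
theorem fockInner_eq_of_tendsto {Φ Ψ : Antidual V} {a b c : FinSub V → ℂ} {A B C : ℂ}
    (hA : ∀ M, HasSum (fun d => pair (frame M) d Φ Φ) (a M)) (ha : Tendsto a atTop (𝓝 A))
    (hB : ∀ M, HasSum (fun d => pair (frame M) d Φ Ψ) (b M)) (hb : Tendsto b atTop (𝓝 B))
    (hC : ∀ M, HasSum (fun d => pair (frame M) d Ψ Ψ) (c M)) (hc : Tendsto c atTop (𝓝 C)) :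
    fockInner Φ Ψ = B := by
  -- On each `M` the squared norm expands sesquilinearly; the expansion survives the limit.
  have key : ∀ κ : ℂ, (fockNorm (Φ + κ • Ψ)).toReal ^ 2 =
      (A + κ * B + conj κ * conj B + conj κ * (κ * C)).re := fun κ => by
    have hs : ∀ M, HasSum (fun d => pair (frame M) d (Φ + κ • Ψ) (Φ + κ • Ψ))
        (a M + κ * b M + conj κ * conj (b M) + conj κ * (κ * c M)) := fun M => by
      have hB' := (Complex.hasSum_conj'.2 (hB M)).mul_left (conj κ)
      simp only [pair_conj] at hB'
      convert! (((hA M).add ((hB M).mul_left κ)).add hB').add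
        (((hC M).mul_left κ).mul_left (conj κ)) using 2 with d
      simp only [pair_add_left, pair_add_right, pair_smul_left, pair_smul_right]
      ring
    have hlim : Tendsto (fun M => a M + κ * b M + conj κ * conj (b M) + conj κ * (κ * c M)) atTop
        (𝓝 (A + κ * B + conj κ * conj B + conj κ * (κ * C))) :=
      ((ha.add (hb.const_mul κ)).add
        (((Complex.continuous_conj.tendsto B).comp hb).const_mul (conj κ))).add
        ((hc.const_mul κ).const_mul (conj κ))
    obtain ⟨h1, h2⟩ := fockNorm_eq_of_tendsto hs hlim
    rw [h1, ENNReal.toReal_ofReal (Real.sqrt_nonneg _), Real.sq_sqrt h2]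
  rw [fockInner]
  simp only [key, Finset.sum_range_succ, Finset.sum_range_zero]
  -- Averaging over `κ = i^p` with weights `i^{-p}` retains only `B`.
  apply Complex.ext <;> simp [pow_succ] <;> ring

/-! ### Hilbert–Schmidt maps -/

section HilbertSchmidt

variable {ι κ : Type*} (b : HilbertBasis ι ℂ V)

/-- `Z` is square summable over the Hilbert basis `b`. -/
def IsHS (Z : V → V) : Prop := Memℓp (fun i => Z (b i)) 2

variable {b}

/-- The family of values of `Z` on the Hilbert basis `b`, in the Hilbert sum of copies of `V`. -/
def hsVec {Z : V → V} (h : IsHS b Z) : lp (fun _ : ι => V) 2 := ⟨fun i => Z (b i), h⟩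

theorem hsVec_apply {Z : V → V} (h : IsHS b Z) (i : ι) : hsVec h i = Z (b i) := rfl

theorem isHS_iff {Z : V → V} : IsHS b Z ↔ Summable fun i => ‖Z (b i)‖ ^ 2 := by
  rw [IsHS, memℓp_gen_iff (by norm_num)]
  simp

theorem norm_sq_hsVec {Z : V → V} (h : IsHS b Z) : ‖hsVec h‖ ^ 2 = ∑' i, ‖Z (b i)‖ ^ 2 := by
  have := lp.norm_rpow_eq_tsum (p := 2) (by norm_num) (hsVec h)
  simpa [hsVec_apply] using this

theorem hasSum_norm_inner_sq (b : HilbertBasis ι ℂ V) (x : V) :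
    HasSum (fun j => ‖(inner ℂ (b j) x : ℂ)‖ ^ 2) (‖x‖ ^ 2) := by
  have h := Complex.hasSum_re (b.hasSum_inner_mul_inner x x)
  convert! h using 1
  · funext j
    rw [← inner_conj_symm x, Complex.conj_mul', ← Complex.ofReal_pow, Complex.ofReal_re]
  · rw [inner_self_eq_norm_sq_to_K]
    norm_cast

/-- By Parseval both sides are the double sum of `|⟨b'_j|Z b_i⟩|²`. Working in `[0, ∞]` allows the
interchange without prior summability. With `Z' = Z` this gives independence of the basis for
symmetric `Z`. -/
theorem tsum_norm_sq_adjoint (b : HilbertBasis ι ℂ V) (b' : HilbertBasis κ ℂ V) {Z Z' : V → V}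
    (hZ : ∀ x y, (inner ℂ y (Z x) : ℂ) = inner ℂ x (Z' y)) :
    ∑' i, ENNReal.ofReal (‖Z (b i)‖ ^ 2) = ∑' j, ENNReal.ofReal (‖Z' (b' j)‖ ^ 2) := by
  have h1 : ∀ i, ENNReal.ofReal (‖Z (b i)‖ ^ 2) =
      ∑' j, ENNReal.ofReal (‖(inner ℂ (b' j) (Z (b i)) : ℂ)‖ ^ 2) := fun i => by
    have := hasSum_norm_inner_sq b' (Z (b i))
    rw [← ENNReal.ofReal_tsum_of_nonneg (fun _ => by positivity) this.summable, this.tsum_eq]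
  have h2 : ∀ j, ENNReal.ofReal (‖Z' (b' j)‖ ^ 2) =
      ∑' i, ENNReal.ofReal (‖(inner ℂ (b i) (Z' (b' j)) : ℂ)‖ ^ 2) := fun j => by
    have := hasSum_norm_inner_sq b (Z' (b' j))
    rw [← ENNReal.ofReal_tsum_of_nonneg (fun _ => by positivity) this.summable, this.tsum_eq]
  simp only [h1, h2, hZ]
  exact ENNReal.tsum_comm

theorem isHS_adjoint {b' : HilbertBasis κ ℂ V} {Z Z' : V → V}
    (hZ : ∀ x y, (inner ℂ y (Z x) : ℂ) = inner ℂ x (Z' y)) (h : IsHS b Z) : IsHS b' Z' := by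
  rw [isHS_iff] at h ⊢
  have h1 := h.tsum_ofReal_ne_top
  rw [tsum_norm_sq_adjoint b b' hZ] at h1
  refine (ENNReal.summable_toReal h1).congr fun j => ?_
  rw [ENNReal.toReal_ofReal (by positivity)]

theorem norm_hsVec_adjoint {b' : HilbertBasis κ ℂ V} {Z Z' : V → V}
    (hZ : ∀ x y, (inner ℂ y (Z x) : ℂ) = inner ℂ x (Z' y)) (h : IsHS b Z) (h' : IsHS b' Z') :
    ‖hsVec h‖ = ‖hsVec h'‖ := by
  have h1 := tsum_norm_sq_adjoint b b' hZ
  rw [← ENNReal.ofReal_tsum_of_nonneg (fun _ => by positivity) (isHS_iff.1 h),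
    ← ENNReal.ofReal_tsum_of_nonneg (fun _ => by positivity) (isHS_iff.1 h'),
    ← norm_sq_hsVec h, ← norm_sq_hsVec h',
    ENNReal.ofReal_eq_ofReal_iff (by positivity) (by positivity)] at h1
  exact (sq_eq_sq₀ (norm_nonneg _) (norm_nonneg _)).1 h1

theorem IsHS.sub {Z W : V → V} (h : IsHS b Z) (h' : IsHS b W) : IsHS b fun x => Z x - W x :=
  Memℓp.sub h h'

theorem hsVec_sub {Z W : V → V} (h : IsHS b Z) (h' : IsHS b W) :
    hsVec h - hsVec h' = hsVec (h.sub h') := rfl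

theorem IsHS.comp {Z : V → V} (h : IsHS b Z) (S : V →L[ℂ] V) : IsHS b fun x => S (Z x) := by
  rw [isHS_iff] at h ⊢
  refine Summable.of_nonneg_of_le (fun _ => by positivity) (fun i => ?_) (h.mul_left (‖S‖ ^ 2))
  rw [← mul_pow]
  gcongr
  exact S.le_opNorm _

theorem norm_hsVec_comp_le {Z : V → V} (h : IsHS b Z) (S : V →L[ℂ] V) :
    ‖hsVec (h.comp S)‖ ≤ ‖S‖ * ‖hsVec h‖ := by
  refine (sq_le_sq₀ (norm_nonneg _) (by positivity)).1 ?_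
  rw [mul_pow, norm_sq_hsVec, norm_sq_hsVec, ← tsum_mul_left]
  refine (isHS_iff.1 (h.comp S)).tsum_le_tsum (fun i => ?_) ((isHS_iff.1 h).mul_left _)
  rw [← mul_pow]
  gcongr
  exact S.le_opNorm _

variable {α : Type*} {l : Filter α}

/-- Split `S_a y_a` as `S_a(y_a - y₀) + S_a y₀`; the uniform bound controls the first term. -/
theorem tendsto_apply_of_strong {S : α → V →L[ℂ] V} {S₀ : V →L[ℂ] V} (hS : ∀ a, ‖S a‖ ≤ 1)
    (hlim : ∀ x, Tendsto (fun a => S a x) l (𝓝 (S₀ x))) {y : α → V} {y₀ : V}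
    (hy : Tendsto y l (𝓝 y₀)) : Tendsto (fun a => S a (y a)) l (𝓝 (S₀ y₀)) := by
  have h1 : Tendsto (fun a => S a (y a - y₀)) l (𝓝 0) := by
    refine squeeze_zero_norm (fun a => (S a).le_of_opNorm_le (hS a) _) ?_
    simpa using (tendsto_iff_norm_sub_tendsto_zero.1 hy)
  simpa using h1.add (hlim y₀)

theorem tendsto_pow_of_strong {S : α → V →L[ℂ] V} {S₀ : V →L[ℂ] V} (hS : ∀ a, ‖S a‖ ≤ 1)
    (hlim : ∀ x, Tendsto (fun a => S a x) l (𝓝 (S₀ x))) (k : ℕ) (x : V) :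
    Tendsto (fun a => (S a ^ k) x) l (𝓝 ((S₀ ^ k) x)) := by
  induction k with
  | zero => simpa using tendsto_const_nhds
  | succ k ih =>
    simp only [pow_succ', mul_apply_eq_comp]
    exact tendsto_apply_of_strong hS hlim ih

theorem norm_pow_le_one {S : V →L[ℂ] V} (hS : ‖S‖ ≤ 1) (k : ℕ) : ‖S ^ k‖ ≤ 1 := by
  cases k with
  | zero => exact ContinuousLinearMap.norm_id_le
  | succ k => exact (norm_pow_le' S k.succ_pos).trans (pow_le_one₀ (norm_nonneg _) hS)

/-- Composition with a Hilbert–Schmidt map upgrades strong convergence of contractions to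
Hilbert–Schmidt norm: the squared differences on the basis are dominated by `(2‖Z b_i‖)²`. -/
theorem tendsto_hsVec_comp_const [l.NeBot] {S : α → V →L[ℂ] V} {S₀ : V →L[ℂ] V}
    (hS : ∀ a, ‖S a‖ ≤ 1) (hlim : ∀ x, Tendsto (fun a => S a x) l (𝓝 (S₀ x))) {Z : V → V}
    (h : IsHS b Z) :
    Tendsto (fun a => hsVec (h.comp (S a))) l (𝓝 (hsVec (h.comp S₀))) := by
  have hS₀ : ∀ x, ‖S₀ x‖ ≤ ‖x‖ := fun x =>
    le_of_tendsto' (hlim x).norm fun a => by simpa using (S a).le_of_opNorm_le (hS a) x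
  rw [tendsto_iff_norm_sub_tendsto_zero]
  have h1 : Tendsto (fun a => ‖hsVec (h.comp (S a)) - hsVec (h.comp S₀)‖ ^ 2) l (𝓝 0) := by
    simp only [hsVec_sub, norm_sq_hsVec]
    have h2 : (0 : ℝ) = ∑' _ : ι, (0 : ℝ) := by simp
    rw [h2]
    refine tendsto_tsum_of_dominated_convergence
      (bound := fun i => (2 * ‖Z (b i)‖) ^ 2) ?_ (fun i => ?_) (Eventually.of_forall fun a i => ?_)
    · simp only [mul_pow]
      exact (isHS_iff.1 h).mul_left _
    · have := ((tendsto_iff_norm_sub_tendsto_zero.1 (hlim (Z (b i)))).pow 2)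
      simpa using this
    · rw [norm_pow, norm_norm]
      gcongr
      refine (norm_sub_le _ _).trans ?_
      have := (S a).le_of_opNorm_le (hS a) (Z (b i))
      have := hS₀ (Z (b i))
      linarith
  have h3 := h1.sqrt
  simpa [Real.sqrt_sq (norm_nonneg _)] using h3

theorem tendsto_hsVec_comp [l.NeBot] {S : α → V →L[ℂ] V} {S₀ : V →L[ℂ] V}
    (hS : ∀ a, ‖S a‖ ≤ 1) (hlim : ∀ x, Tendsto (fun a => S a x) l (𝓝 (S₀ x))) {Z : α → V → V}
    {Z₀ : V → V} (h : ∀ a, IsHS b (Z a)) (h₀ : IsHS b Z₀)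
    (hZ : Tendsto (fun a => hsVec (h a)) l (𝓝 (hsVec h₀))) :
    Tendsto (fun a => hsVec ((h a).comp (S a))) l (𝓝 (hsVec (h₀.comp S₀))) := by
  have h1 : Tendsto (fun a => hsVec (((h a).sub h₀).comp (S a))) l (𝓝 0) := by
    have h3 : Tendsto (fun a => ‖hsVec ((h a).sub h₀)‖) l (𝓝 0) := by
      simpa only [hsVec_sub] using tendsto_iff_norm_sub_tendsto_zero.1 hZ
    exact squeeze_zero_norm (fun a => (norm_hsVec_comp_le ((h a).sub h₀) (S a)).trans
      (mul_le_of_le_one_left (norm_nonneg _) (hS a))) h3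
  have h2 := h1.add (tendsto_hsVec_comp_const hS hlim h₀)
  rw [zero_add] at h2
  refine h2.congr fun a => ?_
  ext i
  simp [hsVec_apply]

end HilbertSchmidt

/-! ### Compressions to finite-dimensional subspaces -/

section Compression

/-- The orthogonal projection on a finite-dimensional subspace. -/
def proj (M : FinSub V) : V →L[ℂ] V := M.1.starProjection

theorem norm_proj_le (M : FinSub V) : ‖proj M‖ ≤ 1 := Submodule.starProjection_norm_le _

/-- The net is constant as soon as `M` contains `x`. -/
theorem tendsto_proj (x : V) :
    Tendsto (fun M : FinSub V => proj M x) atTop (𝓝 ((1 : V →L[ℂ] V) x)) := by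
  refine tendsto_const_nhds.congr' ?_
  filter_upwards [eventually_ge_atTop (⟨Submodule.span ℂ {x}, inferInstance⟩ : FinSub V)] with M hM
  have hx : x ∈ M.1 := (show Submodule.span ℂ {x} ≤ M.1 from hM)
    (Submodule.mem_span_singleton_self x)
  exact (Submodule.starProjection_eq_self_iff.2 hx).symm

theorem inner_proj (M : FinSub V) (x y : V) :
    (inner ℂ (proj M x) y : ℂ) = inner ℂ x (proj M y) :=
  Submodule.inner_starProjection_left_eq_right _ x y

theorem frameProj_frame (M : FinSub V) (w : V) : frameProj (frame M) w = proj M w := by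
  refine Submodule.eq_starProjection_of_mem_of_inner_eq_zero ?_ ?_ |>.symm
  · exact Submodule.sum_mem _ fun j _ => Submodule.smul_mem _ _ (stdOrthonormalBasis ℂ M.1 j).2
  · intro x hx
    rw [← span_frame M] at hx
    induction hx using Submodule.span_induction with
    | mem x hx =>
      obtain ⟨i, rfl⟩ := hx
      rw [inner_sub_left, sub_eq_zero, frameProj, sum_inner]
      simp [inner_smul_left, orthonormal_iff_ite.1 (orthonormal_frame M)]
    | zero => simp
    | add x y _ _ hx hy => rw [inner_add_right, hx, hy, add_zero]
    | smul c x _ hx => rw [inner_smul_right, hx, mul_zero]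

theorem proj_frame (M : FinSub V) (i : Fin (Module.finrank ℂ M.1)) :
    proj M (frame M i) = frame M i :=
  Submodule.starProjection_eq_self_iff.2 (stdOrthonormalBasis ℂ M.1 i).2

/-- The Hilbert–Schmidt inner product of compressions may be computed in any Hilbert basis. -/
theorem hasSum_inner_proj {ι : Type*} (b : HilbertBasis ι ℂ V) (M : FinSub V)
    (Z W : V →L⋆[ℂ] V) :
    HasSum (fun j => (inner ℂ (Z (proj M (b j))) (W (proj M (b j))) : ℂ))
      (∑ i, inner ℂ (Z (frame M i)) (W (frame M i))) := by
  -- Once `P_M b_j` is expanded in the frame, summation over `j` is Parseval's identity for pairs of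
  -- frame vectors.
  have h1 : ∀ j, (inner ℂ (Z (proj M (b j))) (W (proj M (b j))) : ℂ) =
      ∑ i, ∑ i', (inner ℂ (frame M i) (b j) * inner ℂ (b j) (frame M i')) *
        inner ℂ (Z (frame M i)) (W (frame M i')) := fun j => by
    rw [← frameProj_frame, frameProj]
    simp only [map_sum, map_smulₛₗ, sum_inner, inner_sum, inner_smul_left, inner_smul_right,
      inner_conj_symm, Finset.mul_sum]
    rw [Finset.sum_comm]
    refine Finset.sum_congr rfl fun i _ => Finset.sum_congr rfl fun i' _ => ?_
    ring
  have h2 : ∑ i, inner ℂ (Z (frame M i)) (W (frame M i)) = ∑ i, ∑ i',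
      (inner ℂ (frame M i) (frame M i') : ℂ) * inner ℂ (Z (frame M i)) (W (frame M i')) := by
    simp [orthonormal_iff_ite.1 (orthonormal_frame M)]
  simp only [h1, h2]
  exact hasSum_sum fun i _ => hasSum_sum fun i' _ =>
    (b.hasSum_inner_mul_inner (frame M i) (frame M i')).mul_right _

variable {X Y : V →L⋆[ℂ] V}

theorem inner_comp_proj {Z : V →L⋆[ℂ] V} (hZ : IsSymm Z) (M : FinSub V) (x y : V) :
    (inner ℂ y (Z (proj M x)) : ℂ) = inner ℂ x (proj M (Z y)) := by
  rw [hZ, inner_proj]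

section HS

variable {ι : Type*} {b : HilbertBasis ι ℂ V}

/-- For symmetric `Z` the maps `Z P_M` and `P_M Z` are transposes of each other, so bounds for
composition on the left carry over to the right. The convergence of `Z P_M` to `Z` is obtained in
the same way. -/
theorem IsHS.comp_proj {Z : V →L⋆[ℂ] V} (hZ : IsSymm Z) (h : IsHS b Z) (M : FinSub V) :
    IsHS b fun x => Z (proj M x) :=
  isHS_adjoint (b := b) (fun x y => by rw [← inner_proj, hZ]) (h.comp (proj M))

theorem norm_hsVec_comp_proj_le {Z : V →L⋆[ℂ] V} (hZ : IsSymm Z) (h : IsHS b Z) (M : FinSub V) :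
    ‖hsVec (h.comp_proj hZ M)‖ ≤ ‖hsVec h‖ := by
  rw [norm_hsVec_adjoint (inner_comp_proj hZ M) (h.comp_proj hZ M) (h.comp (proj M))]
  exact (norm_hsVec_comp_le _ _).trans (mul_le_of_le_one_left (norm_nonneg _) (norm_proj_le M))

theorem tendsto_hsVec_comp_proj {Z : V →L⋆[ℂ] V} (hZ : IsSymm Z) (h : IsHS b Z) :
    Tendsto (fun M => hsVec (h.comp_proj hZ M)) atTop (𝓝 (hsVec h)) := by
  have h1 := tendsto_hsVec_comp_const norm_proj_le tendsto_proj h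
  rw [tendsto_iff_norm_sub_tendsto_zero] at h1 ⊢
  refine h1.congr fun M => ?_
  rw [hsVec_sub, hsVec_sub]
  refine norm_hsVec_adjoint (fun x y => ?_) _ _
  rw [inner_sub_right, inner_sub_right, inner_comp_proj hZ M]
  exact congrArg _ (hZ x y)

/-- Convergence of, and bounds for, the traces of products of compressions. -/
theorem trace_limit (hX : IsSymm X) (hY : IsSymm Y) (hbX : IsHS b X) (hbY : IsHS b Y)
    {S : FinSub V → V →L[ℂ] V} {S₀ : V →L[ℂ] V} (hS : ∀ M, ‖S M‖ ≤ 1)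
    (hlim : ∀ x, Tendsto (fun M => S M x) atTop (𝓝 (S₀ x)))
    {R : FinSub V → V →L[ℂ] V} (hR : ∀ M, ‖R M‖ ≤ 1)
    (hRlim : ∀ x, Tendsto (fun M => R M x) atTop (𝓝 ((1 : V →L[ℂ] V) x))) (k : ℕ) :
    Tendsto (fun M => ∑ i, (inner ℂ ((S M ^ k) (R M (X (frame M i)))) (Y (frame M i)) : ℂ)) atTop
        (𝓝 (inner ℂ (hsVec (hbX.comp (S₀ ^ k))) (hsVec hbY))) := by
  -- The finite trace becomes an inner product in the fixed Hilbert sum, where both entries converge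
  -- in norm.
  have h1 : ∀ M, ∑ i, (inner ℂ ((S M ^ k) (R M (X (frame M i)))) (Y (frame M i)) : ℂ) =
      inner ℂ (hsVec (((hbX.comp_proj hX M).comp (R M)).comp (S M ^ k)))
        (hsVec (hbY.comp_proj hY M)) := fun M => by
    have h2 := hasSum_inner_proj b M ((S M ^ k).comp ((R M).comp X)) Y
    have h3 := lp.hasSum_inner (𝕜 := ℂ) (hsVec (((hbX.comp_proj hX M).comp (R M)).comp (S M ^ k)))
      (hsVec (hbY.comp_proj hY M))
    exact h2.unique h3
  simp only [h1]
  refine Tendsto.inner ?_ (tendsto_hsVec_comp_proj hY hbY)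
  exact tendsto_hsVec_comp (fun M => norm_pow_le_one (hS M) k) (tendsto_pow_of_strong hS hlim k)
    (fun M => (hbX.comp_proj hX M).comp (R M)) hbX
    (tendsto_hsVec_comp hR hRlim (fun M => hbX.comp_proj hX M) hbX
      (tendsto_hsVec_comp_proj hX hbX))

/-- Cauchy–Schwarz for the Hilbert–Schmidt inner product; the bound does not depend on `M` and
serves as the dominating series. -/
theorem norm_trace_le (hX : IsSymm X) (hY : IsSymm Y) (hbX : IsHS b X) (hbY : IsHS b Y)
    (M : FinSub V) {S R : V →L[ℂ] V} {q : ℝ} (hS : ‖S‖ ≤ q) (hR : ‖R‖ ≤ 1) (k : ℕ) :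
    ‖∑ i, (inner ℂ ((S ^ k) (R (X (frame M i)))) (Y (frame M i)) : ℂ)‖ ≤
      ‖hsVec hbX‖ * ‖hsVec hbY‖ * q ^ k := by
  have hSk : ‖S ^ k‖ ≤ q ^ k := by
    cases k with
    | zero => rw [pow_zero, pow_zero]; exact ContinuousLinearMap.norm_id_le
    | succ k => exact (norm_pow_le' S k.succ_pos).trans (by gcongr)
  have h2 := hasSum_inner_proj b M ((S ^ k).comp (R.comp X)) Y
  have h3 := lp.hasSum_inner (𝕜 := ℂ) (hsVec (((hbX.comp_proj hX M).comp R).comp (S ^ k)))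
    (hsVec (hbY.comp_proj hY M))
  have h4 : ∑ i, (inner ℂ ((S ^ k) (R (X (frame M i)))) (Y (frame M i)) : ℂ) = _ := h2.unique h3
  rw [h4]
  have hq : 0 ≤ q := (norm_nonneg _).trans hS
  calc _ ≤ _ := norm_inner_le_norm _ _
    _ ≤ (q ^ k * ‖hsVec hbX‖) * ‖hsVec hbY‖ := by
      refine mul_le_mul ?_ (norm_hsVec_comp_proj_le hY hbY M) (norm_nonneg _) (by positivity)
      refine (norm_hsVec_comp_le ((hbX.comp_proj hX M).comp R) (S ^ k)).trans
        (mul_le_mul hSk ?_ (norm_nonneg _) (by positivity))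
      exact (norm_hsVec_comp_le (hbX.comp_proj hX M) R).trans
        ((mul_le_of_le_one_left (norm_nonneg _) hR).trans (norm_hsVec_comp_proj_le hX hbX M))
    _ = _ := by ring

end HS
end Compression

/-! ### The two families of traces and their common limit -/

section Limit

variable (X Y : V →L⋆[ℂ] V)

/-- The product `P_M X P_M Y`. -/
def gaussStep (M : FinSub V) : V →L[ℂ] V := (proj M).comp (X.comp ((proj M).comp Y))

/-- The product `X P_M Y`. -/
def fredholmStep (M : FinSub V) : V →L[ℂ] V := X.comp ((proj M).comp Y)

variable {X Y}

theorem norm_fredholmStep_le (M : FinSub V) : ‖fredholmStep X Y M‖ ≤ ‖X‖ * ‖Y‖ := by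
  refine ContinuousLinearMap.opNorm_le_bound _ (by positivity) fun x => ?_
  refine (X.le_opNorm _).trans ?_
  rw [mul_assoc]
  gcongr
  exact ((proj M).le_of_opNorm_le (norm_proj_le M) _).trans (by simpa using Y.le_opNorm x)

theorem norm_gaussStep_le (M : FinSub V) : ‖gaussStep X Y M‖ ≤ ‖X‖ * ‖Y‖ := by
  refine ContinuousLinearMap.opNorm_le_bound _ (by positivity) fun x => ?_
  refine ((proj M).le_of_opNorm_le (norm_proj_le M) _).trans ?_
  rw [one_mul]
  exact (fredholmStep X Y M).le_of_opNorm_le (norm_fredholmStep_le M) x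

theorem tendsto_fredholmStep (x : V) :
    Tendsto (fun M => fredholmStep X Y M x) atTop (𝓝 ((X.comp Y : V →L[ℂ] V) x)) :=
  (X.continuous.tendsto _).comp (tendsto_proj (Y x))

theorem tendsto_gaussStep (x : V) :
    Tendsto (fun M => gaussStep X Y M x) atTop (𝓝 ((X.comp Y : V →L[ℂ] V) x)) :=
  tendsto_apply_of_strong norm_proj_le tendsto_proj (tendsto_fredholmStep x)

/-- `P_M X` intertwines `P_M Y P_M X` with `P_M X P_M Y`, so the iterate passes to the left of `P_M
X`. -/
theorem frameTrace_eq (M : FinSub V) (k : ℕ) :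
    frameTrace (frame M) X Y k =
      ∑ i, inner ℂ ((gaussStep X Y M ^ k) (proj M (X (frame M i)))) (Y (frame M i)) := by
  rw [frameTrace]
  refine Finset.sum_congr rfl fun i _ => ?_
  simp only [frameProj_frame]
  rw [← inner_proj]
  congr 1
  have h : Function.Semiconj (fun v => proj M (X v)) (fun v => proj M (Y (proj M (X v))))
      (gaussStep X Y M) := fun v => rfl
  rw [FunLike.coe_pow_eq_iterate]
  exact h.iterate_right k (frame M i)

/-- On `M`, `(P_M Y X)^(k+1) = P_M Y (X P_M Y)^k X`; the symmetry of `Y` then moves it to the other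
entry. -/
theorem trace_compression_eq (hY : IsSymm Y) (M : FinSub V) (k : ℕ) :
    LinearMap.trace ℂ M.1 (compression (Y.comp X) M ^ (k + 1)) =
      ∑ i, inner ℂ ((fredholmStep X Y M ^ k) ((1 : V →L[ℂ] V) (X (frame M i))))
        (Y (frame M i)) := by
  rw [LinearMap.trace_eq_sum_inner _ (stdOrthonormalBasis ℂ M.1)]
  refine Finset.sum_congr rfl fun i _ => ?_
  have h : ∀ (k : ℕ) (v : M.1), ((compression (Y.comp X) M ^ (k + 1)) v : V) =
      proj M (Y ((fredholmStep X Y M ^ k) (X v))) := by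
    intro k v
    induction k generalizing v with
    | zero => rfl
    | succ k ih =>
      rw [pow_succ, Module.End.mul_apply, ih, pow_succ, mul_apply_eq_comp]
      rfl
  rw [Submodule.coe_inner, h, ← inner_proj]
  change inner ℂ (proj M (frame M i)) (Y ((fredholmStep X Y M ^ k) (X (frame M i)))) = _
  rw [proj_frame, hY]
  rfl

end Limit

/-! ### Convergence of the exponentials -/

theorem tendsto_primSeries {α : Type*} {l : Filter α} {p : α → ℕ → ℂ} {p₀ : ℕ → ℂ} {H r : ℝ}
    (hr : 0 ≤ r) (hr1 : r < 1) (hp : ∀ a k, ‖p a k‖ ≤ H * r ^ k)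
    (hlim : ∀ k, Tendsto (fun a => p a k) l (𝓝 (p₀ k))) {z : ℂ} (hz : ‖z‖ ≤ 1) :
    Tendsto (fun a => primSeries (p a) z) l (𝓝 (primSeries p₀ z)) := by
  refine tendsto_tsum_of_dominated_convergence (bound := fun k => 1 * (H * (r * 1) ^ k))
    ((summable_geometric_bound H hr zero_le_one (by simpa using hr1)).mul_left 1) (fun k => ?_)
    (Eventually.of_forall fun a k => norm_primSeries_term_le (hp a) hz k)
  exact ((hlim k).mul_const _).div_const _

theorem det_compression_eq (X Y : V →L⋆[ℂ] V) (hq : ‖X‖ * ‖Y‖ < 1) (M : FinSub V) {t : ℂ}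
    (ht : ‖t‖ ≤ 1) :
    LinearMap.det (LinearMap.id + compression (-(t • Y.comp X)) M) =
      Complex.exp (-primSeries
        (fun k => LinearMap.trace ℂ M.1 (compression (Y.comp X) M ^ (k + 1))) t) := by
  let T : M.1 →L[ℂ] M.1 := M.1.orthogonalProjectionOnto ∘L (Y.comp X) ∘L M.1.subtypeL
  have hT : ∀ x : M.1, ‖T x‖ ≤ ‖X‖ * ‖Y‖ * ‖x‖ := fun x => by
    refine (M.1.norm_orthogonalProjectionOnto_apply_le _).trans ?_
    refine (Y.le_opNorm _).trans ?_
    rw [mul_comm ‖X‖, mul_assoc]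
    gcongr
    exact X.le_opNorm _
  have htT : ‖t‖ * ‖T‖ < 1 :=
    lt_of_le_of_lt ((mul_le_of_le_one_left (norm_nonneg T) ht).trans
      (ContinuousLinearMap.opNorm_le_bound T (by positivity) hT)) hq
  refine Eq.trans ?_ (det_one_sub_smul_eq_exp T htT)
  congr 1
  ext x
  simp [compression, T, sub_eq_add_neg]

/-! ### Trace class -/

/-- Symmetry turns `⟨b_j|Z f_i⟩` into `⟨f_i|Z b_j⟩`, and Bessel's inequality applies for each `j`.
-/
theorem sum_norm_sq_le {ι : Type*} {b : HilbertBasis ι ℂ V} {Z : V →L⋆[ℂ] V} (hZ : IsSymm Z)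
    (h : IsHS b Z) {n : ℕ} {f : Fin n → V} (hf : Orthonormal ℂ f) :
    ∑ i, ‖Z (f i)‖ ^ 2 ≤ ‖hsVec h‖ ^ 2 := by
  rw [norm_sq_hsVec]
  have h1 : HasSum (fun j => ∑ i, ‖(inner ℂ (b j) (Z (f i)) : ℂ)‖ ^ 2) (∑ i, ‖Z (f i)‖ ^ 2) :=
    hasSum_sum fun i _ => hasSum_norm_inner_sq b (Z (f i))
  refine hasSum_le (fun j => ?_) h1 (isHS_iff.1 h).hasSum
  simp only [fun i => hZ (f i) (b j)]
  exact hf.sum_inner_products_le _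

/-- By symmetry `⟨e_i|YX f_i⟩ = ⟨X f_i|Y e_i⟩`, which is at most half the sum of the two squared
norms. -/
theorem isTraceClass_comp {ι : Type*} {b : HilbertBasis ι ℂ V} {X Y : V →L⋆[ℂ] V}
    (hX : IsSymm X) (hY : IsSymm Y) (hbX : IsHS b X) (hbY : IsHS b Y) :
    IsTraceClass (Y.comp X) := by
  refine ⟨(‖hsVec hbX‖ ^ 2 + ‖hsVec hbY‖ ^ 2) / 2, fun n e f he hf => ?_⟩
  have h1 : ∀ i, ‖(inner ℂ (e i) ((Y.comp X : V →L[ℂ] V) (f i)) : ℂ)‖ ≤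
      (‖X (f i)‖ ^ 2 + ‖Y (e i)‖ ^ 2) / 2 := fun i => by
    rw [ContinuousLinearMap.comp_apply, hY]
    refine (norm_inner_le_norm _ _).trans ?_
    nlinarith [sq_nonneg (‖X (f i)‖ - ‖Y (e i)‖)]
  refine (Finset.sum_le_sum fun i _ => h1 i).trans ?_
  rw [← Finset.sum_div, Finset.sum_add_distrib]
  have := sum_norm_sq_le hX hbX hf
  have := sum_norm_sq_le hY hbY he
  linarith

/-! ### The main theorem -/

/-- The pairings of two Gaussians and the Fredholm determinant are governed by the same series. -/
theorem exists_traceSeries {ι : Type*} {b : HilbertBasis ι ℂ V} {X Y : V →L⋆[ℂ] V}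
    (hX : IsSymm X) (hY : IsSymm Y) (hbX : IsHS b X) (hbY : IsHS b Y) (hX1 : ‖X‖ < 1)
    (hY1 : ‖Y‖ < 1) :
    ∃ L : ℂ → ℂ, ContinuousOn L (Metric.closedBall 0 1) ∧ L 0 = 0 ∧
      (∀ t : ℂ, ‖t‖ ≤ 1 → HasFredholmDet (-(t • Y.comp X)) (Complex.exp (-L t))) ∧
      ∃ a : FinSub V → ℂ,
        (∀ M, HasSum (fun d => pair (frame M) d (gaussian X) (gaussian Y)) (a M)) ∧
        Tendsto a atTop (𝓝 (Complex.exp ((1 / 2 : ℂ) * L 1))) := by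
  have hq : ‖X‖ * ‖Y‖ < 1 := by nlinarith [norm_nonneg X, norm_nonneg Y]
  have hq0 : 0 ≤ ‖X‖ * ‖Y‖ := by positivity
  -- The traces decay like `(r²)^k`, hence the coefficients of the recursion, in which every other
  -- index is empty, like `r^j`.
  obtain ⟨r, hr, hr1, hqr⟩ : ∃ r : ℝ, 0 < r ∧ r < 1 ∧ ‖X‖ * ‖Y‖ ≤ r ^ 2 := by
    refine ⟨√((1 + ‖X‖ * ‖Y‖) / 2), by positivity, ?_, ?_⟩
    · rw [Real.sqrt_lt' one_pos]; linarith
    · rw [Real.sq_sqrt (by positivity)]; linarith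
  have hr2 : r ^ 2 < 1 := pow_lt_one₀ hr.le hr1 two_ne_zero
  set H : ℝ := ‖hsVec hbX‖ * ‖hsVec hbY‖
  -- By symmetry of `Y`, `p₀ k` is the trace of `(YX)^(k+1)` computed in the basis `b`.
  let p₀ : ℕ → ℂ := fun k => inner ℂ (hsVec (hbX.comp ((X.comp Y : V →L[ℂ] V) ^ k))) (hsVec hbY)
  let p : FinSub V → ℕ → ℂ := fun M => frameTrace (frame M) X Y
  let p' : FinSub V → ℕ → ℂ := fun M k =>
    LinearMap.trace ℂ M.1 (compression (Y.comp X) M ^ (k + 1))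
  have hone : ‖(1 : V →L[ℂ] V)‖ ≤ 1 := ContinuousLinearMap.norm_id_le
  have hp : ∀ M k, ‖p M k‖ ≤ H * (r ^ 2) ^ k := fun M k => by
    simp only [p, frameTrace_eq]
    exact norm_trace_le hX hY hbX hbY M ((norm_gaussStep_le M).trans hqr) (norm_proj_le M) k
  have hp' : ∀ M k, ‖p' M k‖ ≤ H * (r ^ 2) ^ k := fun M k => by
    simp only [p', trace_compression_eq hY]
    exact norm_trace_le hX hY hbX hbY M ((norm_fredholmStep_le M).trans hqr) hone k
  have hlim : ∀ k, Tendsto (fun M => p M k) atTop (𝓝 (p₀ k)) := fun k => by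
    simp only [p, frameTrace_eq]
    exact trace_limit hX hY hbX hbY (fun M => (norm_gaussStep_le M).trans hq.le)
      tendsto_gaussStep norm_proj_le tendsto_proj k
  have hlim' : ∀ k, Tendsto (fun M => p' M k) atTop (𝓝 (p₀ k)) := fun k => by
    simp only [p', trace_compression_eq hY]
    exact trace_limit hX hY hbX hbY (fun M => (norm_fredholmStep_le M).trans hq.le)
      tendsto_fredholmStep (fun _ => hone) (fun _ => tendsto_const_nhds) k
  have hp₀ : ∀ k, ‖p₀ k‖ ≤ H * (r ^ 2) ^ k := fun k =>
    le_of_tendsto' (hlim k).norm fun M => hp M k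
  refine ⟨primSeries p₀, fun t ht => ?_, by simp [primSeries], fun t ht => ?_,
    fun M => Complex.exp ((1 / 2 : ℂ) * primSeries (p M) 1),
    fun M => hasSum_pair_gaussian (frame M) hX hY hr hr1 (hp M), ?_⟩
  · have ht' : t ∈ Metric.ball (0 : ℂ) (1 / r) := by
      refine Metric.closedBall_subset_ball ?_ ht
      rwa [lt_div_iff₀ hr, one_mul]
    refine (hasDerivAt_primSeries (by positivity) ?_ hp₀ ht').continuousAt.continuousWithinAt
    rw [pow_two, mul_assoc, mul_one_div_cancel hr.ne', mul_one]
    exact hr1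
  · rw [HasFredholmDet]
    simp only [fun M => det_compression_eq X Y hq M ht]
    exact (Complex.continuous_exp.tendsto _).comp
      (tendsto_primSeries (by positivity) hr2 hp' hlim' ht).neg
  · exact (Complex.continuous_exp.tendsto _).comp
      ((tendsto_primSeries (by positivity) hr2 hp hlim (by simp)).const_mul _)

/-- Two continuous square roots of a nowhere vanishing function on `[0, 1]` that agree at `0` agree
throughout; `exp(-L(t)/2)` is one of them. -/
theorem isSqrtFredholmDet_iff {T : V →L[ℂ] V} {L : ℂ → ℂ}
    (hcont : ContinuousOn L (Metric.closedBall 0 1)) (h0 : L 0 = 0)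
    (hdet : ∀ t : ℂ, ‖t‖ ≤ 1 → HasFredholmDet (-(t • T)) (Complex.exp (-L t))) (w : ℂ) :
    IsSqrtFredholmDet T w ↔ w = Complex.exp (-((1 / 2 : ℂ) * L 1)) := by
  let s : ℝ → ℂ := fun t => Complex.exp (-((1 / 2 : ℂ) * L t))
  have hnorm : ∀ t ∈ Set.Icc (0 : ℝ) 1, ‖(t : ℂ)‖ ≤ 1 := fun t ht => by
    rw [Complex.norm_real, Real.norm_of_nonneg ht.1]
    exact ht.2
  have hs : ContinuousOn s (Set.Icc 0 1) := by
    refine Complex.continuous_exp.comp_continuousOn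
      ((continuousOn_const.mul (hcont.comp Complex.continuous_ofReal.continuousOn ?_)).neg)
    intro t ht
    simpa using hnorm t ht
  have hs0 : s 0 = 1 := by simp [s, h0]
  have hs2 : ∀ t : ℝ, s t ^ 2 = Complex.exp (-L t) := fun t => by
    rw [← Complex.exp_nat_mul]
    congr 1
    push_cast
    ring
  have hs1 : s 1 = Complex.exp (-((1 / 2 : ℂ) * L 1)) := by simp [s]
  rw [← hs1]
  constructor
  · rintro ⟨s', hs', hs0', hdet', rfl⟩
    refine isPreconnected_Icc.eq_of_sq_eq hs' hs (fun t ht => ?_) (fun _ => Complex.exp_ne_zero _)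
      (Set.left_mem_Icc.2 zero_le_one) (hs0'.trans hs0.symm) (Set.right_mem_Icc.2 zero_le_one)
    have := tendsto_nhds_unique (hdet' t ht) (hdet t (hnorm t ht))
    simpa [hs2] using this
  · rintro rfl
    refine ⟨s, hs, hs0, fun t ht => ?_, rfl⟩
    rw [hs2]
    exact hdet t (hnorm t ht)

end
end BosonicFock


theorem mainTheorem5 {V : Type*} [NormedAddCommGroup V] [InnerProductSpace ℂ V] [CompleteSpace V]
    (X Y : V →L⋆[ℂ] V)
    (hX : BosonicFock.IsSymm X) (hX' : BosonicFock.IsHilbertSchmidt X) (hX1 : ‖X‖ < 1)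
    (hY : BosonicFock.IsSymm Y) (hY' : BosonicFock.IsHilbertSchmidt Y) (hY1 : ‖Y‖ < 1) :
    BosonicFock.gaussian X ∈ BosonicFock.fockSpace V ∧
    BosonicFock.gaussian Y ∈ BosonicFock.fockSpace V ∧
    BosonicFock.IsTraceClass (Y.comp X) ∧
    ∃ w : ℂ, (∀ w' : ℂ, BosonicFock.IsSqrtFredholmDet (Y.comp X) w' ↔ w' = w) ∧ w ≠ 0 ∧
      BosonicFock.fockInner (BosonicFock.gaussian X) (BosonicFock.gaussian Y) = w⁻¹ := by
  obtain ⟨σ, b, hb⟩ := hX'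
  obtain ⟨σ', b', hb'⟩ := hY'
  have hbX : BosonicFock.IsHS b X := BosonicFock.isHS_iff.2 hb
  -- Symmetry of `Y` transfers square summability from its own basis to that of `X`.
  have hbY : BosonicFock.IsHS b Y :=
    BosonicFock.isHS_adjoint (b := b') hY (BosonicFock.isHS_iff.2 hb')
  -- The diagonal cases give finiteness of the norms and the square terms needed for polarization.
  obtain ⟨_, _, _, _, aX, haX, haX'⟩ := BosonicFock.exists_traceSeries hX hX hbX hbX hX1 hX1
  obtain ⟨_, _, _, _, aY, haY, haY'⟩ := BosonicFock.exists_traceSeries hY hY hbY hbY hY1 hY1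
  obtain ⟨L, hL, hL0, hdet, a, ha, ha'⟩ := BosonicFock.exists_traceSeries hX hY hbX hbY hX1 hY1
  refine ⟨?_, ?_, BosonicFock.isTraceClass_comp hX hY hbX hbY,
    Complex.exp (-((1 / 2 : ℂ) * L 1)), BosonicFock.isSqrtFredholmDet_iff hL hL0 hdet,
    Complex.exp_ne_zero _, ?_⟩
  · rw [BosonicFock.fockSpace, Set.mem_ofPred_eq, (BosonicFock.fockNorm_eq_of_tendsto haX haX').1]
    exact ENNReal.ofReal_lt_top
  · rw [BosonicFock.fockSpace, Set.mem_ofPred_eq, (BosonicFock.fockNorm_eq_of_tendsto haY haY').1]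
    exact ENNReal.ofReal_lt_top
  · rw [BosonicFock.fockInner_eq_of_tendsto haX haX' ha ha' haY haY', Complex.exp_neg, inv_inv]
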